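/- Let $\mathbb F_q$ be a finite field with $q$ elements. On the field $\mathbb F_q((T^{-1}))$ of formal Laurent series in $T^{-1}$, let $|0|=0$ and $|\xi|=q^{-N}$ if $\xi=\sum_{m\ge N}a_mT^{-m}$ with $a_m\in\mathbb F_q$ and $a_N\neq 0$. The height $H(P)$ of a polynomial $P(X)$ with coefficients in $\mathbb F_q[T]$ is the maximum of the absolute values of its coefficients. An element $\alpha$ of $\mathbb F_q((T^{-1}))$ is algebraic if it is a root of a nonzero polynomial over $\mathbb F_q[T]$; its degree and its height $H(\alpha)$ are the degree in $X$ and the height of its minimal defining polynomial over $\mathbb F_q[T]$, that is, of the polynomial in $\mathbb F_q[T][X]$, unique up to a factor in $\mathbb F_q^{\times}$, which is irreducible in $\mathbb F_q[T][X]$ and vanishes at $\alpha$. For $\xi\in\mathbb F_q((T^{-1}))$ and an integer $n\ge 1$, let $w_n(\xi)$ be the supremum in $[-\infty,+\infty]$ of the real numbers $w$ for which $$0<|P(\xi)|<H(P)^{-w}$$ has infinitely many solutions in polynomials $P(X)$ over $\mathbb F_q[T]$ of degree at most $n$, and let $w_n^*(\xi)$ be the supremum in $[-\infty,+\infty]$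 of the real numbers $w^*$ for which $$0<|\xi-\alpha|<H(\alpha)^{-w^*-1}$$ has infinitely many solutions in algebraic elements $\alpha$ of $\mathbb F_q((T^{-1}))$ of degree at most $n$. Then, for every $\xi\in\mathbb F_q((T^{-1}))$ and every integer $n\ge 1$, $$w_n(\xi)-n+1\le w_n^*(\xi)\le w_n(\xi),$$ where $+\infty-n+1=+\infty$. -/

import Mathlib

open scoped NNReal Polynomial

namespace PowerSeriesApprox

noncomputable section

/-- The field `F((T⁻¹))` of formal Laurent series in `T⁻¹`: an element is `∑_{n ≥ N} a_n T^{-n}`,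
and its coefficient of index `n : ℤ` is `a_n`. So the uniformizer `single 1 1` is `T⁻¹`. -/
abbrev Kinf (F : Type*) [Field F] := LaurentSeries F

variable {F : Type*} [Field F]

/-- The absolute value on `F((T⁻¹))`, for `F` finite with `q` elements: `|0| = 0`, and `|ξ| = q^{-N}`
if `ξ = ∑_{n ≥ N} a_n T^{-n}` with `a_N ≠ 0`. -/
def absv (ξ : Kinf F) : ℝ≥0 :=
  open Classical in if ξ = 0 then 0 else (Nat.card F : ℝ≥0) ^ (-ξ.order)

/-- The canonical embedding `F[T] → F((T⁻¹))`, sending the variable `T` to `T = (T⁻¹)⁻¹`, which is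
the series with a single coefficient `1` at index `-1`. -/
def embed (F : Type*) [Field F] : F[X] →+* Kinf F :=
  Polynomial.eval₂RingHom HahnSeries.C (HahnSeries.single (-1 : ℤ) (1 : F))

/-- The value `P(ξ)` of a polynomial `P(X)` with coefficients in `F[T]`. -/
def evalAt (ξ : Kinf F) (P : F[X][X]) : Kinf F :=
  P.eval₂ (embed F) ξ

/-- The height `H(P)` of `P(X)` over `F[T]`: the maximum of the absolute values of its
coefficients. -/
def height (P : F[X][X]) : ℝ≥0 :=
  P.support.sup fun i => absv (embed F (P.coeff i))

/-- `P` is a minimal defining polynomial over `F[T]` of `α`: it is irreducible in `F[T][X]` (hence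
primitive) and vanishes at `α`. It exists exactly when `α` is algebraic, it is then unique up to a
nonzero constant factor in `F`; its degree and its height are the degree and the height of `α`. -/
def IsMinDefPoly (α : Kinf F) (P : F[X][X]) : Prop :=
  Irreducible P ∧ evalAt α P = 0

/-- `w_n(ξ)`: the supremum, in the extended reals, of the real numbers `w` for which
`0 < |P(ξ)| < H(P)^{-w}` has infinitely many solutions in polynomials `P(X)` over `F[T]` of degree
at most `n`. -/
def wExp (n : ℕ) (ξ : Kinf F) : EReal :=
  sSup ((fun w : ℝ => (w : EReal)) '' {w : ℝ |
    {P : F[X][X] | P.natDegree ≤ n ∧ 0 < absv (evalAt ξ P) ∧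
      absv (evalAt ξ P) < height P ^ (-w)}.Infinite})

/-- `w_n^*(ξ)`: the supremum, in the extended reals, of the real numbers `w` for which
`0 < |ξ - α| < H(α)^{-w-1}` has infinitely many solutions in algebraic elements `α` of `F((T⁻¹))`
of degree at most `n`. -/
def wStarExp (n : ℕ) (ξ : Kinf F) : EReal :=
  sSup ((fun w : ℝ => (w : EReal)) '' {w : ℝ |
    {α : Kinf F | ∃ P : F[X][X], IsMinDefPoly α P ∧ P.natDegree ≤ n ∧ 0 < absv (ξ - α) ∧
      absv (ξ - α) < height P ^ (-w - 1)}.Infinite})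

end

end PowerSeriesApprox

namespace PowerSeriesApprox

open Polynomial

/-! ### The embedding of F[T], the absolute value as a valuation, and heights as degrees in T. -/

section Basic

variable {F : Type*} [Field F]

/-! Only finitely many polynomials have bounded degree and height, so both exponents are governed by
uniform lower bounds, `LowerBound` for |P(ξ)| and `StarLowerBound` for |ξ - α|. The theorem becomes
two implications between such bounds.

For w* ≤ w, expanding the minimal polynomial P of α at ξ gives |P(ξ)| ≪ |ξ - α| H(P) when |ξ - α| <
1 (`LowerBound.starLowerBound`).

For w - n + 1 ≤ w*, a small value |P(ξ)| must produce an algebraic element close to ξ. Let P be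
irreducible and separable of degree d ≥ 2. Its discriminant is a nonzero polynomial in T, hence of
absolute value at least 1, and this forces the Newton polygon of P at ξ to show a zero within about
Δ = |P(ξ)| H(P)^(d-2) of ξ (`one_le_mul_pow_of_separable`). That zero lives in an algebraic closure
and may fail to lie in F((T⁻¹)).

`exists_root_near` replaces it by a zero β in F((T⁻¹)) of another polynomial R. Let m be the last
index at which the Taylor coefficients at ξ are dominant on the disc of radius Δ. If p does not
divide m, the Hasse derivative of order m - 1 has a dominant linear coefficient, and Hensel's lemma
applies. If p divides m, write P = ∑ X^i T^j D_ij(X)^p; some D_ij inherits the situation with radius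
about Δ^(1/p) and with H(D_ij)^p ≤ H(P), and one recurses. This gives |ξ - β|^k ≪ Δ with H(R)^k ≤
H(P), so the k-th power of the bound for β loses nothing, and Δ ≫ H(P)^(-s-1) yields the exponent s
+ n - 1.

Inseparable polynomials reduce to smaller degree by P = ∑ T^j D_j^p, whose terms have distinct
absolute values when nonzero; reducible ones follow by multiplicativity; if ξ is algebraic of degree
at most n, Liouville's inequality suffices (`StarLowerBound.lowerBound`). -/

theorem absv_of_ne_zero {x : Kinf F} (hx : x ≠ 0) :
    absv x = (Nat.card F : ℝ≥0) ^ (-x.order) := by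
  simp [absv, hx]

theorem embed_C (a : F) : embed F (Polynomial.C a) = HahnSeries.C a := by
  simp [embed]

theorem embed_X : embed F Polynomial.X = HahnSeries.single (-1 : ℤ) (1 : F) := by
  simp [embed]

theorem embed_monomial (k : ℕ) (a : F) :
    embed F (Polynomial.monomial k a) = HahnSeries.single (-(k : ℤ)) a := by
  rw [← Polynomial.C_mul_X_pow_eq_monomial, map_mul, map_pow, embed_C, embed_X,
    HahnSeries.single_pow, HahnSeries.C_apply, HahnSeries.single_mul_single]
  simp

theorem coeff_embed (c : F[X]) (N : ℤ) :
    (embed F c).coeff N = if N ≤ 0 then c.coeff N.natAbs else 0 := by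
  induction c using Polynomial.induction_on' with
  | add a b ha hb => rw [map_add, HahnSeries.coeff_add, ha, hb]; split_ifs <;> simp
  | monomial k a =>
    rw [embed_monomial, HahnSeries.coeff_single, Polynomial.coeff_monomial]
    split_ifs <;> first | rfl | omega

theorem embed_injective : Function.Injective (embed F) := by
  intro a b h
  ext k
  have := congrArg (fun x : Kinf F => x.coeff (-(k : ℤ))) h
  simpa [coeff_embed] using this

/-- The degree in `T` of a polynomial over `F[T]`. -/
noncomputable def degT (P : F[X][X]) : ℕ := P.support.sup fun i => (P.coeff i).natDegree

theorem natDegree_coeff_le_degT (P : F[X][X]) (i : ℕ) : (P.coeff i).natDegree ≤ degT P := by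
  by_cases h : P.coeff i = 0
  · simp [h]
  · exact Finset.le_sup (f := fun i => (P.coeff i).natDegree) (Polynomial.mem_support_iff.2 h)

theorem degT_le_iff {P : F[X][X]} {h : ℕ} :
    degT P ≤ h ↔ ∀ i, (P.coeff i).natDegree ≤ h :=
  ⟨fun H i => (natDegree_coeff_le_degT P i).trans H, fun H => Finset.sup_le fun i _ => H i⟩

theorem coeff_coeff_swap {R : Type*} [CommRing R] (P : R[X][X]) (i j : ℕ) :
    ((Polynomial.Bivariate.swap P).coeff i).coeff j = (P.coeff j).coeff i := by
  induction P using Polynomial.induction_on' with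
  | add a b ha hb => simp [ha, hb]
  | monomial k a =>
    induction a using Polynomial.induction_on' with
    | add a b ha hb => simp [ha, hb]
    | monomial l a =>
      rw [Polynomial.Bivariate.swap_monomial_monomial]
      simp only [Polynomial.coeff_monomial]
      split_ifs <;> simp_all [Polynomial.coeff_monomial]

/-- Exchanging the two variables makes the degree in T an ordinary `natDegree`, so that heights are
multiplicative because degrees add. -/
theorem degT_eq_natDegree_swap (P : F[X][X]) :
    degT P = (Polynomial.Bivariate.swap P).natDegree := by
  apply le_antisymm
  · rw [degT_le_iff]
    intro i
    rw [Polynomial.natDegree_le_iff_coeff_eq_zero]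
    intro N hN
    rw [← coeff_coeff_swap, Polynomial.coeff_eq_zero_of_natDegree_lt hN,
      Polynomial.coeff_zero]
  · rw [Polynomial.natDegree_le_iff_coeff_eq_zero]
    intro N hN
    ext i
    rw [coeff_coeff_swap, Polynomial.coeff_zero]
    exact Polynomial.coeff_eq_zero_of_natDegree_lt ((natDegree_coeff_le_degT P i).trans_lt hN)

theorem finite_setOf_natDegree_le {R : Type*} [Semiring R] (n : ℕ) {S : Set R} (hS : S.Finite) :
    {P : R[X] | P.natDegree ≤ n ∧ ∀ i, P.coeff i ∈ S}.Finite := by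
  have : Finite S := hS
  let f : {P : R[X] | P.natDegree ≤ n ∧ ∀ i, P.coeff i ∈ S} → (Fin (n + 1) → S) :=
    fun P i => ⟨P.1.coeff i, P.2.2 i⟩
  have hf : Function.Injective f := by
    intro P Q h
    ext i
    by_cases hi : i < n + 1
    · simpa [f] using congrFun h ⟨i, hi⟩
    · rw [Polynomial.coeff_eq_zero_of_natDegree_lt (by have := P.2.1; omega),
        Polynomial.coeff_eq_zero_of_natDegree_lt (by have := Q.2.1; omega)]
  exact Finite.of_injective f hf

theorem evalAt_eq_eval_map (ξ : Kinf F) (P : F[X][X]) :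
    evalAt ξ P = (P.map (embed F)).eval ξ := by
  rw [evalAt, Polynomial.eval_map]

theorem evalAt_mul (ξ : Kinf F) (P Q : F[X][X]) :
    evalAt ξ (P * Q) = evalAt ξ P * evalAt ξ Q := Polynomial.eval₂_mul _ _

variable [Finite F]

theorem one_lt_card : (1 : ℝ≥0) < Nat.card F := by
  exact_mod_cast Finite.one_lt_card

theorem card_pos : (0 : ℝ≥0) < Nat.card F := zero_lt_one.trans one_lt_card

variable (F) in
/-- The absolute value `absv` as a valuation. -/
noncomputable def absVal : Valuation (Kinf F) ℝ≥0 where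
  toFun := absv
  map_zero' := by simp [absv]
  map_one' := by simp [absv]
  map_mul' x y := by
    by_cases hx : x = 0
    · simp [absv, hx]
    by_cases hy : y = 0
    · simp [absv, hy]
    rw [absv_of_ne_zero hx, absv_of_ne_zero hy, absv_of_ne_zero (mul_ne_zero hx hy),
      HahnSeries.order_mul hx hy, neg_add, zpow_add₀ card_pos.ne']
  map_add_le_max' x y := by
    by_cases hx : x = 0
    · simp [hx]
    by_cases hy : y = 0
    · simp [hy]
    by_cases hxy : x + y = 0
    · simp [absv, hxy]
    rw [absv_of_ne_zero hx, absv_of_ne_zero hy, absv_of_ne_zero hxy]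
    have := HahnSeries.min_order_le_order_add hxy
    rcases min_le_iff.1 this with h | h
    · exact le_max_of_le_left (zpow_le_zpow_right₀ one_lt_card.le (neg_le_neg h))
    · exact le_max_of_le_right (zpow_le_zpow_right₀ one_lt_card.le (neg_le_neg h))

theorem absVal_apply (x : Kinf F) : absVal F x = absv x := rfl

theorem absVal_single (N : ℤ) {a : F} (ha : a ≠ 0) :
    absVal F (HahnSeries.single N a) = (Nat.card F : ℝ≥0) ^ (-N) := by
  rw [absVal_apply, absv_of_ne_zero (by simpa using ha), HahnSeries.order_single ha]

theorem exists_absVal_eq {x : Kinf F} (hx : x ≠ 0) :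
    ∃ N : ℤ, absVal F x = (Nat.card F : ℝ≥0) ^ N :=
  ⟨_, absv_of_ne_zero hx⟩

omit [Finite F] in
theorem embed_ne_zero {c : F[X]} (hc : c ≠ 0) : embed F c ≠ 0 :=
  (map_ne_zero_iff _ embed_injective).2 hc

theorem absVal_embed {c : F[X]} (hc : c ≠ 0) :
    absVal F (embed F c) = (Nat.card F : ℝ≥0) ^ c.natDegree := by
  rw [absVal_apply, absv_of_ne_zero (embed_ne_zero hc)]
  have : (embed F c).order = -(c.natDegree : ℤ) := by
    apply le_antisymm
    · apply HahnSeries.order_le_of_coeff_ne_zero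
      simpa [coeff_embed] using hc
    · by_contra! hlt
      have h1 := HahnSeries.coeff_order_eq_zero.not.2 (embed_ne_zero hc)
      rw [coeff_embed] at h1
      split_ifs at h1 with h2
      · exact h1 (Polynomial.coeff_eq_zero_of_natDegree_lt (by omega))
      · exact h1 rfl
  rw [this, neg_neg, zpow_natCast]

theorem one_le_absVal_embed {c : F[X]} (hc : c ≠ 0) : 1 ≤ absVal F (embed F c) := by
  rw [absVal_embed hc]
  exact one_le_pow₀ one_lt_card.le

theorem absVal_embed_le {c : F[X]} {h : ℕ} (hc : c.natDegree ≤ h) :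
    absVal F (embed F c) ≤ (Nat.card F : ℝ≥0) ^ h := by
  by_cases h0 : c = 0
  · simp [h0]
  · rw [absVal_embed h0]
    exact pow_le_pow_right₀ one_lt_card.le hc

theorem height_eq {P : F[X][X]} (hP : P ≠ 0) : height P = (Nat.card F : ℝ≥0) ^ degT P := by
  apply le_antisymm
  · refine Finset.sup_le fun i _ => ?_
    exact absVal_embed_le (natDegree_coeff_le_degT P i)
  · obtain ⟨i, hi, h⟩ := Finset.exists_mem_eq_sup P.support
      (Polynomial.support_nonempty.2 hP) fun i => (P.coeff i).natDegree
    rw [degT, h, ← absVal_embed (Polynomial.mem_support_iff.1 hi)]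
    exact Finset.le_sup (f := fun i => absv (embed F (P.coeff i))) hi

theorem one_le_height {P : F[X][X]} (hP : P ≠ 0) : 1 ≤ height P := by
  rw [height_eq hP]
  exact one_le_pow₀ one_lt_card.le

omit [Finite F] in
theorem degT_mul {P Q : F[X][X]} (hP : P ≠ 0) (hQ : Q ≠ 0) :
    degT (P * Q) = degT P + degT Q := by
  simp only [degT_eq_natDegree_swap, map_mul]
  exact Polynomial.natDegree_mul (by simpa using hP) (by simpa using hQ)

omit [Finite F] in
theorem degT_le_of_dvd {P Q : F[X][X]} (h : P ∣ Q) (hQ : Q ≠ 0) : degT P ≤ degT Q := by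
  obtain ⟨R, rfl⟩ := h
  rw [degT_mul (left_ne_zero_of_mul hQ) (right_ne_zero_of_mul hQ)]
  exact Nat.le_add_right _ _

theorem absVal_evalAt_of_natDegree_eq_zero {P : F[X][X]} (h : P.natDegree = 0) (hP : P ≠ 0)
    (ξ : Kinf F) : absVal F (evalAt ξ P) = (Nat.card F : ℝ≥0) ^ degT P := by
  obtain ⟨c, rfl⟩ := Polynomial.natDegree_eq_zero.1 h
  have hc : c ≠ 0 := by simpa using hP
  have : degT (Polynomial.C c) = c.natDegree := by
    apply le_antisymm
    · rw [degT_le_iff]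
      intro i
      rw [Polynomial.coeff_C]
      split_ifs <;> simp
    · simpa using natDegree_coeff_le_degT (Polynomial.C c) 0
  rw [this, ← absVal_embed hc]
  simp [evalAt]

theorem finite_setOf_degT_le (n h : ℕ) :
    {P : F[X][X] | P.natDegree ≤ n ∧ degT P ≤ h}.Finite := by
  have h1 := finite_setOf_natDegree_le (R := F) h (S := Set.univ) Set.finite_univ
  have h2 := finite_setOf_natDegree_le n h1
  refine h2.subset fun P hP => ⟨hP.1, fun i => ⟨?_, fun _ => trivial⟩⟩
  exact (natDegree_coeff_le_degT P i).trans hP.2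

end Basic

/-! ### Hensel's lemma in a disc of F((T⁻¹)). -/

section Hensel

/-- A polynomial over a complete ring whose reduction is `X + c` has a root. -/
theorem exists_isRoot_of_coeff_mem {R : Type*} [CommRing R] (I : Ideal R) [IsAdicComplete I R]
    (g : R[X]) (h1 : g.coeff 1 = 1) (h2 : ∀ i, 2 ≤ i → g.coeff i ∈ I) : ∃ z, g.IsRoot z := by
  -- Roots of g are fixed points of X - g, which is contracting because its nonconstant coefficients
  -- lie in I; its iterates from 0 converge I-adically.
  set h : R[X] := Polynomial.X - g with hh
  have hcoeff : ∀ i, 1 ≤ i → h.coeff i ∈ I := by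
    intro i hi
    rcases hi.eq_or_lt with rfl | hi
    · simp [hh, h1]
    · rw [hh, Polynomial.coeff_sub, Polynomial.coeff_X_of_ne_one (by omega), zero_sub]
      exact I.neg_mem (h2 i hi)
  have hcontr : ∀ (n : ℕ) (a b : R), a - b ∈ I ^ n → h.eval a - h.eval b ∈ I ^ (n + 1) := by
    intro n a b hab
    rw [Polynomial.eval_eq_sum_range, Polynomial.eval_eq_sum_range, ← Finset.sum_sub_distrib]
    refine Ideal.sum_mem _ fun i _ => ?_
    rw [← mul_sub]
    rcases Nat.eq_zero_or_pos i with rfl | hi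
    · simp
    · rw [pow_succ']
      refine Ideal.mul_mem_mul (hcoeff i hi) ?_
      exact Ideal.mem_of_dvd _ (sub_dvd_pow_sub_pow a b i) hab
  let c : ℕ → R := fun n => (fun b => h.eval b)^[n] 0
  have hc : ∀ n, c (n + 1) = h.eval (c n) := fun n => Function.iterate_succ_apply' _ _ _
  have hstep : ∀ n, c n - c (n + 1) ∈ I ^ n := by
    intro n
    induction n with
    | zero => simp
    | succ n ih =>
      rw [hc n, hc (n + 1)]
      exact hcontr n _ _ ih
  have hcauchy : ∀ {m n}, m ≤ n → c m ≡ c n [SMOD (I ^ m • ⊤ : Ideal R)] := by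
    intro m n hmn
    rw [smul_eq_mul, Ideal.mul_top, SModEq.sub_mem]
    induction n, hmn using Nat.le_induction with
    | base => simp
    | succ n hmn ih =>
      have := Ideal.add_mem _ ih (Ideal.pow_le_pow_right hmn (hstep n))
      simpa using this
  obtain ⟨a, ha⟩ := IsPrecomplete.prec' c hcauchy
  refine ⟨a, ?_⟩
  have hroot : h.eval a - a = 0 := by
    refine IsHausdorff.haus' (I := I) _ fun n => ?_
    have h1 := ha n
    have h2 := ha (n + 1)
    rw [smul_eq_mul, Ideal.mul_top, SModEq.sub_mem] at *
    have h3 := hcontr n _ _ h1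
    rw [← hc] at h3
    have h4 := Ideal.sub_mem _ h2 h3
    have h5 : h.eval a - a - 0 = c (n + 1) - a - (c (n + 1) - h.eval a) := by ring
    rw [h5]
    exact Ideal.pow_le_pow_right n.le_succ h4
  have : h.eval a = a - g.eval a := by simp [hh]
  rw [this] at hroot
  simpa using hroot

variable {F : Type*} [Field F] [Finite F]

theorem le_order_of_absVal_le {x : Kinf F} (hx : x ≠ 0) {N : ℤ}
    (h : absVal F x ≤ (Nat.card F : ℝ≥0) ^ (-N)) : N ≤ x.order := by
  rw [absVal_apply, absv_of_ne_zero hx, zpow_le_zpow_iff_right₀ one_lt_card] at h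
  omega

theorem exists_ofPowerSeries_eq {x : Kinf F} (h : absVal F x ≤ 1) :
    ∃ f : PowerSeries F, HahnSeries.ofPowerSeries ℤ F f = x := by
  by_cases hx : x = 0
  · exact ⟨0, by simp [hx]⟩
  have h0 : 0 ≤ x.order := le_order_of_absVal_le hx (by simpa using h)
  obtain ⟨n, hn⟩ := Int.eq_ofNat_of_zero_le h0
  exact ⟨_, LaurentSeries.X_order_mul_powerSeriesPart hn.symm⟩

theorem absVal_ofPowerSeries_le (f : PowerSeries F) :
    absVal F (HahnSeries.ofPowerSeries ℤ F f) ≤ 1 := by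
  by_cases hf : f = 0
  · simp [hf]
  have hf' : HahnSeries.ofPowerSeries ℤ F f ≠ 0 := by
    rwa [Ne, map_eq_zero_iff _ HahnSeries.ofPowerSeries_injective]
  rw [absVal_apply, absv_of_ne_zero hf']
  apply zpow_le_one_of_nonpos₀ one_lt_card.le
  by_contra! hlt
  have h1 := HahnSeries.coeff_order_eq_zero.not.2 hf'
  rw [PowerSeries.coeff_coe, if_pos (by omega)] at h1
  exact h1 rfl

theorem mem_span_X_of_absVal_lt {f : PowerSeries F}
    (h : absVal F (HahnSeries.ofPowerSeries ℤ F f) < 1) :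
    f ∈ Ideal.span {(PowerSeries.X : PowerSeries F)} := by
  rw [Ideal.mem_span_singleton, PowerSeries.X_dvd_iff]
  by_contra hne
  have hne' : (HahnSeries.ofPowerSeries ℤ F f).coeff 0 ≠ 0 := by
    rw [PowerSeries.coeff_coe]
    simpa using hne
  have hf' : HahnSeries.ofPowerSeries ℤ F f ≠ 0 := by
    intro h0
    simp [h0] at hne'
  have := HahnSeries.order_le_of_coeff_ne_zero hne'
  rw [absVal_apply, absv_of_ne_zero hf'] at h
  exact absurd h (not_lt.2 (one_le_zpow₀ one_lt_card.le (by omega)))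

/-- Hensel's lemma in a disc: if the linear coefficient of `A` strictly dominates the higher ones
on the disc of radius `|δ|`, and dominates the constant one, then `A` has a root in that disc. -/
theorem exists_root_of_dominant_coeff_one (A : (Kinf F)[X]) {δ : Kinf F} (hδ : δ ≠ 0)
    (h1 : A.coeff 1 ≠ 0) (h0 : absVal F (A.coeff 0) ≤ absVal F (A.coeff 1) * absVal F δ)
    (h2 : ∀ i, 2 ≤ i →
      absVal F (A.coeff i) * absVal F δ ^ i < absVal F (A.coeff 1) * absVal F δ) :
    ∃ y, absVal F y ≤ absVal F δ ∧ A.eval y = 0 := by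
  have hu : A.coeff 1 * δ ≠ 0 := mul_ne_zero h1 hδ
  have hu' : 0 < absVal F (A.coeff 1 * δ) := zero_lt_iff.2 ((absVal F).ne_zero_iff.2 hu)
  -- Rescaling the disc to the unit disc and normalizing the linear coefficient gives a polynomial
  -- over F[[T⁻¹]] that reduces to X + c.
  set g : (Kinf F)[X] := Polynomial.C (A.coeff 1 * δ)⁻¹ * A.comp (Polynomial.C δ * Polynomial.X)
    with hg
  have hgc : ∀ i, g.coeff i = (A.coeff 1 * δ)⁻¹ * (A.coeff i * δ ^ i) := by
    intro i
    rw [hg, Polynomial.coeff_C_mul, Polynomial.comp_C_mul_X_coeff]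
  have hgv : ∀ i, absVal F (g.coeff i) =
      (absVal F (A.coeff i) * absVal F δ ^ i) / (absVal F (A.coeff 1) * absVal F δ) := by
    intro i
    rw [hgc, map_mul, map_inv₀, map_mul, map_mul, map_pow, div_eq_inv_mul]
  rw [map_mul] at hu'
  have hg1 : g.coeff 1 = 1 := by rw [hgc, pow_one, inv_mul_cancel₀ hu]
  have hg2 : ∀ i, 2 ≤ i → absVal F (g.coeff i) < 1 := by
    intro i hi
    rw [hgv, div_lt_one hu']
    exact h2 i hi
  have hgle : ∀ i, absVal F (g.coeff i) ≤ 1 := by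
    intro i
    rcases lt_or_ge i 2 with hi | hi
    · interval_cases i
      · rw [hgv, div_le_one hu']
        simpa using h0
      · simp [hg1]
    · exact (hg2 i hi).le
  obtain ⟨G, hG⟩ := (Polynomial.mem_lifts g).1 ((Polynomial.lifts_iff_coeff_lifts
    (f := HahnSeries.ofPowerSeries ℤ F) g).2 fun i => exists_ofPowerSeries_eq (hgle i))
  have hGc : ∀ i, HahnSeries.ofPowerSeries ℤ F (G.coeff i) = g.coeff i := by
    intro i
    rw [← hG, Polynomial.coeff_map]
  obtain ⟨z, hz⟩ := exists_isRoot_of_coeff_mem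
    (Ideal.span {(PowerSeries.X : PowerSeries F)}) G
    (HahnSeries.ofPowerSeries_injective (Γ := ℤ) (by rw [hGc, hg1, map_one]))
    (fun i hi => mem_span_X_of_absVal_lt (by rw [hGc]; exact hg2 i hi))
  refine ⟨δ * HahnSeries.ofPowerSeries ℤ F z, ?_, ?_⟩
  · rw [map_mul]
    exact mul_le_of_le_one_right' (absVal_ofPowerSeries_le z)
  · have : g.eval (HahnSeries.ofPowerSeries ℤ F z) = 0 := by
      rw [← hG, Polynomial.eval_map, Polynomial.eval₂_at_apply, hz, map_zero]
    rw [hg, Polynomial.eval_mul, Polynomial.eval_C, Polynomial.eval_comp] at this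
    simpa [h1, hδ] using this

end Hensel

/-! ### Decomposition of polynomials over F[T] into p-th powers. -/

section FrobeniusDecomposition

variable {F : Type*} [Field F]

/-- A polynomial over a perfect field of characteristic `p` is a combination of `p`-th powers with
coefficients `1, X, …, X ^ (p - 1)`. -/
theorem exists_eq_sum_X_pow_mul_pow [Finite F] (p : ℕ) [Fact p.Prime] [CharP F p] (c : F[X])
    {h : ℕ} (hc : c.natDegree ≤ h) :
    ∃ d : ℕ → F[X], c = ∑ j ∈ Finset.range p, X ^ j * d j ^ p ∧
      ∀ j, p * (d j).natDegree ≤ h := by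
  have hp := (Fact.out : p.Prime)
  rw [c.as_sum_range' (h + 1) (by omega)]
  refine Finset.sum_induction _ (fun c : F[X] => ∃ d : ℕ → F[X],
    c = ∑ j ∈ Finset.range p, X ^ j * d j ^ p ∧ ∀ j, p * (d j).natDegree ≤ h) ?_ ?_ ?_
  · rintro a b ⟨d, rfl, hd⟩ ⟨e, rfl, he⟩
    refine ⟨d + e, ?_, fun j => ?_⟩
    · simp only [Pi.add_apply, add_pow_char, mul_add, Finset.sum_add_distrib]
    · have := natDegree_add_le (d j) (e j)
      rcases le_max_iff.1 this with h' | h'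
      · exact (Nat.mul_le_mul_left p h').trans (hd j)
      · exact (Nat.mul_le_mul_left p h').trans (he j)
  · exact ⟨0, by simp [hp.ne_zero], by simp⟩
  · intro k hk
    rw [Finset.mem_range] at hk
    obtain ⟨a, ha⟩ := (PerfectRing.bijective_frobenius (R := F) (p := p)).surjective (c.coeff k)
    dsimp only at ha
    refine ⟨fun j => if j = k % p then monomial (k / p) a else 0, ?_, fun j => ?_⟩
    · rw [Finset.sum_eq_single (k % p)]
      · dsimp only
        rw [if_pos rfl, monomial_pow, ha, X_pow_mul_monomial, Nat.div_add_mod']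
      · intro j _ hj
        simp [hj, hp.ne_zero]
      · intro hk'
        exact absurd (Finset.mem_range.2 (Nat.mod_lt _ hp.pos)) hk'
    · dsimp only
      split_ifs
      · refine (Nat.mul_le_mul_left p (natDegree_monomial_le a)).trans ?_
        exact (Nat.mul_div_le k p).trans (by omega)
      · simp

theorem degT_add_le_of_le {P Q : F[X][X]} {h : ℕ} (hP : degT P ≤ h) (hQ : degT Q ≤ h) :
    degT (P + Q) ≤ h := by
  rw [degT_le_iff] at *
  intro i
  rw [coeff_add]
  exact (natDegree_add_le _ _).trans (max_le (hP i) (hQ i))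

theorem degT_monomial_le (k : ℕ) (c : F[X]) : degT (monomial k c) ≤ c.natDegree := by
  rw [degT_le_iff]
  intro i
  rw [coeff_monomial]
  split_ifs <;> simp

/-- Each coefficient c splits as ∑ T^j d_j^p, and then c X^(pk) = ∑ T^j (d_j X^k)^p. The factor p in
the last bound says that H(D_j)^p ≤ H(P), which keeps exponents unchanged when passing to D_j. -/
theorem exists_expand_eq_sum_pow [Finite F] (p : ℕ) [Fact p.Prime] [CharP F p] (P : F[X][X])
    {N h : ℕ} (hN : P.natDegree ≤ N) (hh : degT P ≤ h) :
    ∃ D : ℕ → F[X][X], expand F[X] p P = ∑ j ∈ Finset.range p, C (X ^ j) * D j ^ p ∧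
      (∀ j, (D j).natDegree ≤ N) ∧ ∀ j, p * degT (D j) ≤ h := by
  have hp := (Fact.out : p.Prime)
  rw [P.as_sum_range' (N + 1) (by omega), map_sum]
  refine Finset.sum_induction _ (fun P : F[X][X] => ∃ D : ℕ → F[X][X],
    P = ∑ j ∈ Finset.range p, C (X ^ j) * D j ^ p ∧
      (∀ j, (D j).natDegree ≤ N) ∧ ∀ j, p * degT (D j) ≤ h) ?_ ?_ ?_
  · rintro a b ⟨d, rfl, hd, hd'⟩ ⟨e, rfl, he, he'⟩
    refine ⟨d + e, ?_, fun j => ?_, fun j => ?_⟩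
    · simp only [Pi.add_apply, add_pow_char, mul_add, Finset.sum_add_distrib]
    · exact (natDegree_add_le _ _).trans (max_le (hd j) (he j))
    · have h1 := (Nat.le_div_iff_mul_le hp.pos).2 ((mul_comm _ _).trans_le (hd' j))
      have h2 := (Nat.le_div_iff_mul_le hp.pos).2 ((mul_comm _ _).trans_le (he' j))
      rw [mul_comm]
      exact (Nat.le_div_iff_mul_le hp.pos).1 (degT_add_le_of_le h1 h2)
  · exact ⟨0, by simp [hp.ne_zero], by simp, by simp [degT]⟩
  · intro k hk
    rw [Finset.mem_range] at hk
    obtain ⟨d, hd, hd'⟩ := exists_eq_sum_X_pow_mul_pow p (P.coeff k)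
      ((natDegree_coeff_le_degT P k).trans hh)
    refine ⟨fun j => monomial k (d j), ?_, fun j => ?_, fun j => ?_⟩
    · rw [expand_monomial]
      nth_rw 1 [hd]
      rw [map_sum]
      refine Finset.sum_congr rfl fun j _ => ?_
      rw [monomial_pow, C_mul_monomial]
    · exact (natDegree_monomial_le _).trans (by omega)
    · exact (Nat.mul_le_mul_left p (degT_monomial_le k _)).trans (hd' j)

/-- Monomials are sorted by their exponent in X modulo p. -/
theorem exists_eq_sum_X_pow_mul_expand {p : ℕ} (hp : 0 < p) (P : F[X][X]) :
    ∃ G : ℕ → F[X][X], P = ∑ i ∈ Finset.range p, X ^ i * expand F[X] p (G i) ∧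
      (∀ i, p * (G i).natDegree ≤ P.natDegree) ∧ ∀ i, degT (G i) ≤ degT P := by
  suffices ∀ N h : ℕ, P.natDegree ≤ N → degT P ≤ h →
      ∃ G : ℕ → F[X][X], P = ∑ i ∈ Finset.range p, X ^ i * expand F[X] p (G i) ∧
        (∀ i, p * (G i).natDegree ≤ N) ∧ ∀ i, degT (G i) ≤ h from this _ _ le_rfl le_rfl
  intro N h hN hh
  rw [P.as_sum_range' (N + 1) (by omega)]
  refine Finset.sum_induction _ (fun P : F[X][X] => ∃ G : ℕ → F[X][X],
    P = ∑ i ∈ Finset.range p, X ^ i * expand F[X] p (G i) ∧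
        (∀ i, p * (G i).natDegree ≤ N) ∧ ∀ i, degT (G i) ≤ h) ?_ ?_ ?_
  · rintro a b ⟨d, rfl, hd, hd'⟩ ⟨e, rfl, he, he'⟩
    refine ⟨d + e, ?_, fun j => ?_, fun j => degT_add_le_of_le (hd' j) (he' j)⟩
    · simp only [Pi.add_apply, map_add, mul_add, Finset.sum_add_distrib]
    · have := natDegree_add_le (d j) (e j)
      rcases le_max_iff.1 this with h' | h'
      · exact (Nat.mul_le_mul_left p h').trans (hd j)
      · exact (Nat.mul_le_mul_left p h').trans (he j)
  · exact ⟨0, by simp, by simp, by simp [degT]⟩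
  · intro k hk
    rw [Finset.mem_range] at hk
    refine ⟨fun j => if j = k % p then monomial (k / p) (P.coeff k) else 0, ?_, fun j => ?_,
      fun j => ?_⟩
    · rw [Finset.sum_eq_single (k % p)]
      · dsimp only
        rw [if_pos rfl, expand_monomial, X_pow_mul_monomial, Nat.div_add_mod']
      · intro j _ hj
        simp [hj]
      · intro hk'
        exact absurd (Finset.mem_range.2 (Nat.mod_lt _ hp)) hk'
    · dsimp only
      split_ifs
      · refine (Nat.mul_le_mul_left p (natDegree_monomial_le _)).trans ?_
        exact (Nat.mul_div_le k p).trans (by omega)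
      · simp
    · dsimp only
      split_ifs
      · exact (degT_monomial_le _ _).trans ((natDegree_coeff_le_degT P k).trans hh)
      · simp [degT]

/-- Since f has degree below p, products with distinct powers of X^p do not overlap. -/
theorem coeff_mul_expand {R : Type*} [CommSemiring R] {p : ℕ} (f W : R[X])
    (hf : f.natDegree < p) (l : ℕ) {s : ℕ} (hs : s < p) :
    (f * expand R p W).coeff (p * l + s) = f.coeff s * W.coeff l := by
  induction W using Polynomial.induction_on' with
  | add a b ha hb => simp [mul_add, ha, hb]
  | monomial k w =>
    rw [expand_monomial, ← C_mul_X_pow_eq_monomial, ← mul_assoc, coeff_mul_X_pow', coeff_mul_C,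
      coeff_monomial]
    rcases lt_trichotomy k l with hkl | rfl | hkl
    · rw [if_neg hkl.ne, mul_zero]
      split_ifs
      · rw [coeff_eq_zero_of_natDegree_lt, zero_mul]
        have : k * p + p ≤ p * l := by nlinarith
        omega
      · rfl
    · rw [if_pos rfl, if_pos (by rw [mul_comm]; omega), mul_comm p k, Nat.add_sub_cancel_left]
    · rw [if_neg hkl.ne', mul_zero, if_neg]
      have : p * l + p ≤ k * p := by nlinarith
      omega

end FrobeniusDecomposition

/-! ### Ultrametric estimates for Taylor coefficients and for sums of p-th powers. -/

section TaylorCoeff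

variable {F : Type*} [Field F]

/-- The Taylor coefficients of `P` at `ξ`. -/
noncomputable def taylorCoeff (ξ : Kinf F) (P : F[X][X]) (l : ℕ) : Kinf F :=
  (taylor ξ (P.map (embed F))).coeff l

theorem taylorCoeff_zero (ξ : Kinf F) (P : F[X][X]) : taylorCoeff ξ P 0 = evalAt ξ P := by
  rw [taylorCoeff, taylor_coeff_zero, evalAt_eq_eval_map]

theorem taylorCoeff_of_natDegree_lt (ξ : Kinf F) (P : F[X][X]) {l : ℕ} (h : P.natDegree < l) :
    taylorCoeff ξ P l = 0 := by
  apply coeff_eq_zero_of_natDegree_lt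
  rw [natDegree_taylor]
  exact natDegree_map_le.trans_lt h

variable [Finite F]

theorem absVal_natCast_le_one (k : ℕ) : absVal F (k : Kinf F) ≤ 1 := by
  have : (k : Kinf F) = embed F (k : F[X]) := (map_natCast _ _).symm
  rw [this]
  simpa using absVal_embed_le (c := (k : F[X])) (h := 0) (by simp)

/-- Taylor coefficients are values of Hasse derivatives, whose binomial factors have absolute value
at most 1. Applied to x and -x, the bound shows that a shift changes the maximum of the coefficients
by a bounded factor only. -/
theorem absVal_coeff_taylor_le {x : Kinf F} {B M : ℝ≥0} (hB : 1 ≤ B) (hx : absVal F x ≤ B)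
    (V : (Kinf F)[X]) {m : ℕ} (hV : V.natDegree ≤ m) (hM : ∀ i, absVal F (V.coeff i) ≤ M)
    (i : ℕ) : absVal F ((taylor x V).coeff i) ≤ B ^ m * M := by
  rw [taylor_coeff, eval_eq_sum_range]
  refine (absVal F).map_sum_le fun j hj => ?_
  rw [Finset.mem_range] at hj
  have hj' : j ≤ m := by have := natDegree_hasseDeriv_le V i; omega
  rw [hasseDeriv_coeff, map_mul, map_mul, map_pow, mul_comm]
  refine mul_le_mul' ((pow_le_pow_left' hx j).trans (pow_le_pow_right₀ hB hj')) ?_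
  exact (mul_le_of_le_one_left' (absVal_natCast_le_one _)).trans (hM _)

theorem absVal_taylorCoeff_le {ξ : Kinf F} {B : ℝ≥0} (hB : 1 ≤ B) (hξ : absVal F ξ ≤ B)
    {P : F[X][X]} {m : ℕ} (hP : P.natDegree ≤ m) (i : ℕ) :
    absVal F (taylorCoeff ξ P i) ≤ B ^ m * (Nat.card F : ℝ≥0) ^ degT P := by
  refine absVal_coeff_taylor_le hB hξ _ (natDegree_map_le.trans hP) (fun i => ?_) i
  rw [coeff_map]
  exact absVal_embed_le (natDegree_coeff_le_degT P i)

theorem absVal_embed_X_pow (j : ℕ) :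
    absVal F (embed F (X ^ j)) = (Nat.card F : ℝ≥0) ^ j := by
  rw [absVal_embed (pow_ne_zero _ X_ne_zero), natDegree_X_pow]

/-- The terms `T ^ j * y_j ^ p` with `0 ≤ j < p` have distinct absolute values, so their sum is at
least as large as each of them. -/
theorem absVal_le_absVal_sum {p : ℕ} (y : ℕ → Kinf F) {j : ℕ} (hj : j < p) :
    absVal F (embed F (X ^ j) * y j ^ p) ≤
      absVal F (∑ i ∈ Finset.range p, embed F (X ^ i) * y i ^ p) := by
  set x : ℕ → Kinf F := fun i => embed F (X ^ i) * y i ^ p with hx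
  obtain ⟨k, hk, hmax⟩ := Finset.exists_max_image (Finset.range p) (fun i => absVal F (x i))
    ⟨j, Finset.mem_range.2 hj⟩
  refine (hmax j (Finset.mem_range.2 hj)).trans ?_
  change absVal F (x k) ≤ absVal F (∑ i ∈ Finset.range p, x i)
  by_cases hk0 : x k = 0
  · simp [hk0]
  have hlt : ∀ i ∈ (Finset.range p).erase k, absVal F (x i) < absVal F (x k) := by
    intro i hi
    rw [Finset.mem_erase] at hi
    refine lt_of_le_of_ne (hmax i hi.2) fun heq => hi.1 ?_
    have hi0 : x i ≠ 0 := by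
      intro h0
      rw [h0, map_zero] at heq
      exact hk0 ((absVal F).zero_iff.1 heq.symm)
    have hp0 : p ≠ 0 := by omega
    have key : ∀ i, x i ≠ 0 → ∃ N : ℤ, absVal F (x i) = (Nat.card F : ℝ≥0) ^ ((i : ℤ) + p * N) := by
      intro i hi
      have hy : y i ≠ 0 := by
        intro h
        exact hi (by simp [hx, h, hp0])
      obtain ⟨N, hN⟩ := exists_absVal_eq hy
      refine ⟨N, ?_⟩
      change absVal F (embed F (X ^ i) * y i ^ p) = _
      rw [(absVal F).map_mul, absVal_embed_X_pow, (absVal F).map_pow, hN, zpow_add₀ card_pos.ne', zpow_natCast,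
        mul_comm (p : ℤ), zpow_mul, zpow_natCast]
    obtain ⟨N, hN⟩ := key i hi0
    obtain ⟨M, hM⟩ := key k hk0
    rw [hN, hM] at heq
    have h1 := zpow_right_injective₀ card_pos one_lt_card.ne' heq
    have h2 : i < p := Finset.mem_range.1 hi.2
    have h3 : k < p := Finset.mem_range.1 hk
    have h4 : ((i : ℤ) + p * N) % p = ((k : ℤ) + p * M) % p := by rw [h1]
    rw [Int.add_mul_emod_self_left, Int.add_mul_emod_self_left] at h4
    rw [Int.emod_eq_of_lt (by omega) (by omega), Int.emod_eq_of_lt (by omega) (by omega)] at h4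
    exact_mod_cast h4
  rw [← Finset.add_sum_erase _ _ hk]
  rw [Valuation.map_add_eq_of_lt_left]
  exact (absVal F).map_sum_lt ((absVal F).ne_zero_iff.2 hk0) hlt

theorem exists_absVal_sum_le {ι : Type*} {s : Finset ι} (x : ι → Kinf F)
    (h : ∑ i ∈ s, x i ≠ 0) : ∃ i ∈ s, absVal F (∑ i ∈ s, x i) ≤ absVal F (x i) := by
  by_contra! hlt
  exact (lt_irrefl _) ((absVal F).map_sum_lt ((absVal F).ne_zero_iff.2 h) hlt)

end TaylorCoeff

/-! ### From Newton polygons to zeros in F((T⁻¹)). -/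

section RootNear

variable {F : Type*} [Field F]

/-- By Frobenius, D(ξ + Y)^p is a polynomial in Y^p whose coefficients are the p-th powers of those
of D(ξ + Y). Hence the block of indices pl, …, pl + p - 1 sees only the Taylor coefficients of index
l of the D_ij, through the shift by ξ of one polynomial of degree below p. -/
theorem taylorCoeff_eq_coeff_taylor_sum {p : ℕ} {P : F[X][X]} {G : ℕ → F[X][X]} {D : ℕ → ℕ → F[X][X]}
    (hG : P = ∑ i ∈ Finset.range p, X ^ i * expand F[X] p (G i))
    (hD : ∀ i, expand F[X] p (G i) = ∑ j ∈ Finset.range p, C (X ^ j) * D i j ^ p)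
    [Fact p.Prime] [CharP F p] (ξ : Kinf F) (l : ℕ) {s : ℕ} (hs : s < p) :
    taylorCoeff ξ P (p * l + s) = (taylor ξ (∑ i ∈ Finset.range p,
      C (∑ j ∈ Finset.range p, embed F (X ^ j) * taylorCoeff ξ (D i j) l ^ p) * X ^ i)).coeff s := by
  have hp := (Fact.out : p.Prime)
  have : CharP (Kinf F) p := by
    have := (HahnSeries.C (Γ := ℤ) (R := F)).charP_iff HahnSeries.C_injective p
    exact this.1 inferInstance
  have hE : ∀ i, taylor ξ ((expand F[X] p (G i)).map (embed F)) = expand (Kinf F) p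
      (∑ j ∈ Finset.range p, C (embed F (X ^ j)) *
        (taylor ξ ((D i j).map (embed F))).map (frobenius (Kinf F) p)) := by
    intro i
    rw [hD i, Polynomial.map_sum, map_sum, map_sum]
    refine Finset.sum_congr rfl fun j _ => ?_
    rw [Polynomial.map_mul, taylor_mul, Polynomial.map_pow, taylor_pow, map_C, taylor_C, map_mul,
      expand_C, ← map_expand, map_frobenius_expand]
  nth_rw 1 [taylorCoeff, hG]
  rw [Polynomial.map_sum, map_sum, map_sum, finsetSum_coeff, finsetSum_coeff]
  refine Finset.sum_congr rfl fun i hi => ?_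
  rw [Polynomial.map_mul, taylor_mul, hE, coeff_mul_expand _ _ _ _ hs, taylor_mul, taylor_C,
    coeff_C_mul, mul_comm, Polynomial.map_pow, map_X, finsetSum_coeff]
  · congr 1
    refine Finset.sum_congr rfl fun j _ => ?_
    rw [coeff_C_mul, coeff_map, frobenius_def, taylorCoeff]
  · rw [natDegree_taylor, Polynomial.map_pow, map_X, natDegree_X_pow]
    exact Finset.mem_range.1 hi

variable [Finite F]

/-- If `P` has a dominant Taylor coefficient at `ξ` of positive index divisible by `p`, on the disc
of radius `Δ`, then one of the polynomials in the decomposition of `P` into `p`-th powers has a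
zero at distance about `Δ ^ (1 / p)` from `ξ`, in the sense of Newton polygons. -/
theorem exists_taylorCoeff_dominant {p : ℕ} [Fact p.Prime] [CharP F p] {P : F[X][X]}
    {G : ℕ → F[X][X]} {D : ℕ → ℕ → F[X][X]}
    (hG : P = ∑ i ∈ Finset.range p, X ^ i * expand F[X] p (G i))
    (hD : ∀ i, expand F[X] p (G i) = ∑ j ∈ Finset.range p, C (X ^ j) * D i j ^ p)
    {ξ : Kinf F} {B : ℝ≥0} (hB : 1 ≤ B) (hξ : absVal F ξ ≤ B) {Δ ρ : ℝ≥0} (hΔ0 : 0 < Δ)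
    (hΔ1 : Δ ≤ 1) (hρ : B ^ (2 * p) * Δ ≤ ρ ^ p) {m : ℕ} (hm : 0 < m) (hpm : p ∣ m)
    (hm0 : taylorCoeff ξ P m ≠ 0)
    (hmax : ∀ l, absVal F (taylorCoeff ξ P l) * Δ ^ l ≤ absVal F (taylorCoeff ξ P m) * Δ ^ m) :
    ∃ i j l, 0 < l ∧ taylorCoeff ξ (D i j) l ≠ 0 ∧
      absVal F (taylorCoeff ξ (D i j) 0) ≤ absVal F (taylorCoeff ξ (D i j) l) * ρ ^ l := by
  have hp := (Fact.out : p.Prime)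
  by_contra! hcon
  obtain ⟨l, rfl⟩ := hpm
  have hl : 0 < l := Nat.pos_of_mul_pos_left hm
  set g : ℕ → ℕ → Kinf F := fun i l =>
    ∑ j ∈ Finset.range p, embed F (X ^ j) * taylorCoeff ξ (D i j) l ^ p with hg
  set U : ℕ → (Kinf F)[X] := fun l => ∑ i ∈ Finset.range p, C (g i l) * X ^ i with hU
  have hUc : ∀ l, ∀ s < p, taylorCoeff ξ P (p * l + s) = (taylor ξ (U l)).coeff s :=
    fun l s hs => taylorCoeff_eq_coeff_taylor_sum hG hD ξ l hs
  have hUcoeff : ∀ l i, (U l).coeff i = if i < p then g i l else 0 := by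
    intro l i
    simp only [hU, finsetSum_coeff, coeff_C_mul_X_pow]
    simp
  have hUdeg : ∀ l, (U l).natDegree ≤ p - 1 := by
    intro l
    refine natDegree_sum_le_of_forall_le _ _ fun i hi => ?_
    have := Finset.mem_range.1 hi
    exact (natDegree_C_mul_X_pow_le _ _).trans (by omega)
  have hBp : B ^ (p - 1) ≤ B ^ p := pow_le_pow_right₀ hB (by omega)
  -- The pair i, j is chosen so that T^j times the p-th power of the l-th coefficient of D_ij
  -- accounts for the dominant coefficient of P, up to the factor B^p.
  obtain ⟨i, hip, hi⟩ := Finset.exists_max_image (Finset.range p) (fun i => absVal F (g i l))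
    ⟨0, Finset.mem_range.2 hp.pos⟩
  have h1 : absVal F (taylorCoeff ξ P (p * l)) ≤ B ^ p * absVal F (g i l) := by
    rw [← add_zero (p * l), hUc l 0 hp.pos]
    refine (absVal_coeff_taylor_le (M := absVal F (g i l)) hB hξ (U l) (hUdeg l) (fun k => ?_)
      0).trans (mul_le_mul_left hBp _)
    rw [hUcoeff]
    split_ifs with hk
    · exact hi k (Finset.mem_range.2 hk)
    · simp
  have hgi : g i l ≠ 0 := by
    intro h0
    rw [h0, map_zero, mul_zero, nonpos_iff_eq_zero] at h1
    exact hm0 ((absVal F).zero_iff.1 h1)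
  obtain ⟨j, hj, h2⟩ := exists_absVal_sum_le _ hgi
  change absVal F (g i l) ≤ _ at h2
  have ha : taylorCoeff ξ (D i j) l ≠ 0 := by
    intro h0
    rw [h0, zero_pow hp.ne_zero, mul_zero, map_zero, nonpos_iff_eq_zero] at h2
    exact hgi ((absVal F).zero_iff.1 h2)
  have h3 := pow_lt_pow_left₀ (hcon i j l hl ha) zero_le hp.ne_zero
  have h4 : absVal F (embed F (X ^ j) * taylorCoeff ξ (D i j) 0 ^ p) ≤ absVal F (g i 0) :=
    absVal_le_absVal_sum (fun j => taylorCoeff ξ (D i j) 0) (Finset.mem_range.1 hj)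
  obtain ⟨s, hs, h5⟩ := Finset.exists_max_image (Finset.range p)
    (fun s => absVal F (taylorCoeff ξ P s)) ⟨0, Finset.mem_range.2 hp.pos⟩
  -- Shifting back by -ξ recovers block 0 from the first p Taylor coefficients of P.
  have h6 : absVal F (g i 0) ≤ B ^ p * absVal F (taylorCoeff ξ P s) := by
    have hU0 : U 0 = taylor (-ξ) (taylor ξ (U 0)) := by
      rw [taylor_taylor]; simp
    have : g i 0 = (U 0).coeff i := by rw [hUcoeff, if_pos (Finset.mem_range.1 hip)]
    rw [this, hU0]
    refine (absVal_coeff_taylor_le (M := absVal F (taylorCoeff ξ P s)) hB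
      (by rwa [Valuation.map_neg]) (taylor ξ (U 0)) (by rw [natDegree_taylor]; exact hUdeg 0)
      (fun k => ?_) i).trans (mul_le_mul_left hBp _)
    rcases lt_or_ge k p with hk | hk
    · rw [← hUc 0 k hk, mul_zero, zero_add]
      exact h5 k (Finset.mem_range.2 hk)
    · rw [coeff_eq_zero_of_natDegree_lt, map_zero]
      · exact zero_le
      · rw [natDegree_taylor]
        have := hUdeg 0
        have := hp.pos
        omega
  have h7 := hmax s
  set A := absVal F (taylorCoeff ξ P (p * l)) with hA
  have hA0 : 0 < A := zero_lt_iff.2 ((absVal F).ne_zero_iff.2 hm0)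
  set e := absVal F (embed F (X ^ j)) with he
  have he0 : 0 < e := by
    rw [he, absVal_embed_X_pow]
    exact pow_pos card_pos _
  have hBpos : 0 < B := zero_lt_one.trans_le hB
  rw [(absVal F).map_mul, (absVal F).map_pow] at h2 h4
  have h8 : A * (ρ ^ p) ^ l * Δ ^ s < B ^ (2 * p) * (A * Δ ^ (p * l)) := by
    calc A * (ρ ^ p) ^ l * Δ ^ s
        ≤ B ^ p * (e * absVal F (taylorCoeff ξ (D i j) l) ^ p) * (ρ ^ p) ^ l * Δ ^ s := by
          gcongr
          exact h1.trans (mul_le_mul_right h2 _)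
      _ = B ^ p * (e * (absVal F (taylorCoeff ξ (D i j) l) * ρ ^ l) ^ p) * Δ ^ s := by
          rw [mul_pow, ← pow_mul, ← pow_mul, mul_comm l p]; ring
      _ < B ^ p * (e * absVal F (taylorCoeff ξ (D i j) 0) ^ p) * Δ ^ s := by
          gcongr
      _ ≤ B ^ p * (B ^ p * absVal F (taylorCoeff ξ P s)) * Δ ^ s := by
          exact mul_le_mul_left (mul_le_mul_right (h4.trans h6) _) _
      _ = B ^ (2 * p) * (absVal F (taylorCoeff ξ P s) * Δ ^ s) := by ring
      _ ≤ B ^ (2 * p) * (A * Δ ^ (p * l)) := by gcongr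
  have h9 : B ^ (2 * p) * (A * Δ ^ (p * l)) ≤ A * (ρ ^ p) ^ l * Δ ^ s := by
    -- Holds because s ≤ p - 1 and l ≥ 1. It leaves a factor Δ^l to be compared with (ρ^p)^l,
    -- besides the Δ^s used for the coefficient of index s.
    have hls : l + s ≤ p * l := by
      have := Finset.mem_range.1 hs
      obtain ⟨r, rfl⟩ := Nat.exists_eq_add_of_le' hp.pos
      nlinarith
    calc B ^ (2 * p) * (A * Δ ^ (p * l)) ≤ B ^ (2 * p) * (A * Δ ^ (l + s)) := by
          exact mul_le_mul_right (mul_le_mul_right (pow_le_pow_of_le_one zero_le hΔ1 hls) _) _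
      _ = A * (B ^ (2 * p) * Δ ^ l) * Δ ^ s := by rw [pow_add]; ring
      _ ≤ A * ((B ^ (2 * p)) ^ l * Δ ^ l) * Δ ^ s := by
          exact mul_le_mul_left (mul_le_mul_right (mul_le_mul_left
            (le_self_pow₀ (one_le_pow₀ hB) hl.ne') _) _) _
      _ = A * (B ^ (2 * p) * Δ) ^ l * Δ ^ s := by rw [mul_pow]
      _ ≤ A * (ρ ^ p) ^ l * Δ ^ s := by gcongr
  exact absurd h8 (not_lt.2 h9)

omit [Finite F] in
theorem taylorCoeff_hasseDeriv (ξ : Kinf F) (P : F[X][X]) (k i : ℕ) :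
    taylorCoeff ξ (hasseDeriv k P) i = ((i + k).choose i : Kinf F) * taylorCoeff ξ P (i + k) := by
  have hmap : (hasseDeriv k P).map (embed F) = hasseDeriv k (P.map (embed F)) := by
    ext1 j
    simp [hasseDeriv_coeff]
  rw [taylorCoeff, taylorCoeff, hmap, taylor_coeff, taylor_coeff]
  have := LinearMap.congr_fun (hasseDeriv_comp i k (R := Kinf F)) (P.map (embed F))
  rw [LinearMap.comp_apply] at this
  rw [this, LinearMap.smul_apply, nsmul_eq_mul, eval_mul, eval_natCast]

/-- The Hasse derivative of order m - 1 moves the dominant coefficient to index 1 and multiplies it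
by m, a unit since m ≠ 0 in F. The other binomial factors have absolute value at most 1, so the
linear coefficient stays dominant and Hensel's lemma applies. -/
theorem exists_root_hasseDeriv {P : F[X][X]} {ξ δ : Kinf F} (hδ : δ ≠ 0) {m : ℕ}
    (hm : 0 < m) (hmF : (m : F) ≠ 0) (hm0 : taylorCoeff ξ P m ≠ 0)
    (hmax : ∀ l, absVal F (taylorCoeff ξ P l) * absVal F δ ^ l ≤
      absVal F (taylorCoeff ξ P m) * absVal F δ ^ m)
    (hlt : ∀ l, m < l → absVal F (taylorCoeff ξ P l) * absVal F δ ^ l <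
      absVal F (taylorCoeff ξ P m) * absVal F δ ^ m) :
    ∃ β, hasseDeriv (m - 1) P ≠ 0 ∧ evalAt β (hasseDeriv (m - 1) P) = 0 ∧
      absVal F (ξ - β) ≤ absVal F δ := by
  obtain ⟨r, rfl⟩ := Nat.exists_eq_add_of_le' hm
  rw [Nat.add_sub_cancel]
  set R := hasseDeriv r P with hR
  have hδ0 : 0 < absVal F δ := zero_lt_iff.2 ((absVal F).ne_zero_iff.2 hδ)
  have hmK : absVal F ((r + 1 : ℕ) : Kinf F) = 1 := by
    have h1 : ((r + 1 : ℕ) : Kinf F) = embed F (C ((r + 1 : ℕ) : F)) := by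
      rw [C_eq_natCast, map_natCast]
    rw [h1, absVal_embed (C_ne_zero.2 hmF), natDegree_C, pow_zero]
  have h0 : (taylor ξ (R.map (embed F))).coeff 0 = taylorCoeff ξ P r := by
    change taylorCoeff ξ R 0 = _
    rw [hR, taylorCoeff_hasseDeriv]
    simp
  have h1 : (taylor ξ (R.map (embed F))).coeff 1 =
      ((r + 1 : ℕ) : Kinf F) * taylorCoeff ξ P (r + 1) := by
    change taylorCoeff ξ R 1 = _
    rw [hR, taylorCoeff_hasseDeriv, Nat.choose_one_right, add_comm 1 r]
  have h1v : absVal F ((taylor ξ (R.map (embed F))).coeff 1) =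
      absVal F (taylorCoeff ξ P (r + 1)) := by rw [h1, (absVal F).map_mul, hmK, one_mul]
  have hcancel : ∀ {a b : ℝ≥0}, a * absVal F δ ^ r ≤ b * absVal F δ ^ r → a ≤ b :=
    fun h => le_of_mul_le_mul_right h (pow_pos hδ0 r)
  have h1ne : (taylor ξ (R.map (embed F))).coeff 1 ≠ 0 := by
    rw [← (absVal F).ne_zero_iff, h1v]
    exact (absVal F).ne_zero_iff.2 hm0
  obtain ⟨y, hy, hroot⟩ := exists_root_of_dominant_coeff_one (taylor ξ (R.map (embed F))) hδ h1ne
    (by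
      rw [h0, h1v]
      apply hcancel
      rw [mul_assoc, ← pow_succ']
      exact hmax r)
    (by
      intro i hi
      have : (taylor ξ (R.map (embed F))).coeff i =
          ((i + r).choose i : Kinf F) * taylorCoeff ξ P (i + r) := by
        change taylorCoeff ξ R i = _
        rw [hR, taylorCoeff_hasseDeriv]
      rw [h1v, this, (absVal F).map_mul]
      refine lt_of_mul_lt_mul_right (a := absVal F δ ^ r) ?_ zero_le
      rw [mul_assoc _ _ (absVal F δ ^ r), mul_assoc _ _ (absVal F δ ^ r), ← pow_succ', mul_assoc,
        ← pow_add]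
      exact (mul_le_of_le_one_left' (absVal_natCast_le_one _)).trans_lt (hlt (i + r) (by omega)))
  refine ⟨y + ξ, ?_, ?_, ?_⟩
  · intro hR0
    rw [hR0] at h1ne
    simp at h1ne
  · rw [evalAt_eq_eval_map, ← taylor_eval, hroot]
  · rw [sub_add_cancel_right, Valuation.map_neg]
    exact hy

omit [Finite F] in
theorem degT_hasseDeriv_le (k : ℕ) (P : F[X][X]) : degT (hasseDeriv k P) ≤ degT P := by
  rw [degT_le_iff]
  intro i
  rw [hasseDeriv_coeff, ← C_eq_natCast]
  exact (natDegree_C_mul_le _ _).trans (natDegree_coeff_le_degT P _)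

/-- Each passage to a p-th root polynomial multiplies k by p, takes a p-th root of the radius and
divides the degree in T by at least p. The degree in X strictly drops, which drives the induction; c
collects the losses. -/
theorem exists_root_near (p : ℕ) [Fact p.Prime] [CharP F p] (ξ : Kinf F) (n : ℕ) :
    ∃ c : ℕ, ∀ (P : F[X][X]) (N : ℕ), P.natDegree ≤ n → c ≤ N →
      (∃ l, 0 < l ∧ taylorCoeff ξ P l ≠ 0 ∧ absVal F (taylorCoeff ξ P 0) ≤
        absVal F (taylorCoeff ξ P l) * ((Nat.card F : ℝ≥0) ^ (-N : ℤ)) ^ l) →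
      ∃ (k : ℕ) (R : F[X][X]) (β : Kinf F), k ≤ p ^ n ∧ R ≠ 0 ∧ R.natDegree ≤ n ∧
        k * degT R ≤ degT P ∧ evalAt β R = 0 ∧
        absVal F (ξ - β) ^ k ≤ (Nat.card F : ℝ≥0) ^ ((c : ℤ) - N) := by
  have hp := (Fact.out : p.Prime)
  set q : ℝ≥0 := (Nat.card F : ℝ≥0) with hq
  have hq1 : 1 < q := one_lt_card
  have hq0 : 0 < q := card_pos
  obtain ⟨b, hb⟩ : ∃ b : ℕ, absVal F ξ ≤ q ^ b := by
    obtain ⟨b, hb⟩ := pow_unbounded_of_one_lt (absVal F ξ) hq1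
    exact ⟨b, hb.le⟩
  induction n with
  | zero =>
    refine ⟨0, fun P N hP _ ⟨l, hl, hl0, _⟩ => absurd ?_ hl0⟩
    exact taylorCoeff_of_natDegree_lt ξ P (by omega)
  | succ n ih =>
    obtain ⟨c, hc⟩ := ih
    refine ⟨p * c + 2 * p * b + p, fun P N hP hN ⟨l, hl, hl0, hle⟩ => ?_⟩
    set Δ : ℝ≥0 := q ^ (-N : ℤ) with hΔ
    have hΔ0 : 0 < Δ := zpow_pos hq0 _
    set f : ℕ → ℝ≥0 := fun l => absVal F (taylorCoeff ξ P l) * Δ ^ l with hf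
    have hf0 : ∀ l, n + 1 < l → f l = 0 := by
      intro l hl
      rw [hf]
      dsimp only
      rw [taylorCoeff_of_natDegree_lt ξ P (by omega), map_zero, zero_mul]
    -- The lexicographic order selects the largest index among the maximizers, so later terms are
    -- strictly smaller, as Hensel's lemma requires.
    obtain ⟨m, -, hm⟩ := Finset.exists_max_image (Finset.range (n + 2))
      (fun l => toLex (f l, l)) ⟨0, by simp⟩
    have hm' : ∀ l ≤ n + 1, f l < f m ∨ f l = f m ∧ l ≤ m := by
      intro l hl
      have := hm l (by simpa [Nat.lt_succ_iff] using hl)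
      rwa [Prod.Lex.le_iff] at this
    have hmax : ∀ l, f l ≤ f m := by
      intro l
      rcases le_or_gt l (n + 1) with h | h
      · rcases hm' l h with h | h
        · exact h.le
        · exact h.1.le
      · rw [hf0 l h]; exact zero_le
    have hl1 : l ≤ n + 1 := by
      by_contra! h
      exact hl0 (taylorCoeff_of_natDegree_lt ξ P (by omega))
    have hfl : 0 < f l := mul_pos (zero_lt_iff.2 ((absVal F).ne_zero_iff.2 hl0)) (pow_pos hΔ0 _)
    have hfm : 0 < f m := hfl.trans_le (hmax l)
    have hlt : ∀ l, m < l → f l < f m := by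
      intro l hl
      rcases le_or_gt l (n + 1) with h | h
      · rcases hm' l h with h | h
        · exact h
        · omega
      · rwa [hf0 l h]
    have hm0 : taylorCoeff ξ P m ≠ 0 := by
      intro h0
      simp [hf, h0] at hfm
    have hmpos : 0 < m := by
      by_contra h
      obtain rfl : m = 0 := by omega
      have h1 := hlt l hl
      have h2 : f 0 ≤ f l := by simpa [hf] using hle
      exact absurd h1 (not_lt.2 h2)
    by_cases hpm : p ∣ m
    · obtain ⟨G, hG, hGd, hGT⟩ := exists_eq_sum_X_pow_mul_expand hp.pos P
      choose D hD hDd hDT using fun i => exists_expand_eq_sum_pow p (G i) le_rfl le_rfl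
      -- With B = q^b and ρ = q^(-M), the condition B^(2p) Δ ≤ ρ^p reads pM ≤ N - 2pb. Rounding
      -- loses less than p, whence the terms 2pb and p in the constant.
      set M : ℕ := (N - 2 * p * b) / p with hM
      have hM1 : p * M ≤ N - 2 * p * b := Nat.mul_div_le _ _
      have hM2 : N - 2 * p * b < p * M + p := Nat.lt_mul_div_succ _ hp.pos
      have hMc : c ≤ M := by
        rw [hM, Nat.le_div_iff_mul_le hp.pos, mul_comm]
        omega
      obtain ⟨i, j, l', hl', hl'0, hle'⟩ := exists_taylorCoeff_dominant (ρ := q ^ (-M : ℤ)) hG hD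
        (one_le_pow₀ hq1.le) hb hΔ0 (zpow_le_one_of_nonpos₀ hq1.le (by omega)) (by
          rw [hΔ, ← pow_mul, ← zpow_natCast, ← zpow_natCast, ← zpow_add₀ hq0.ne', ← zpow_mul]
          apply zpow_le_zpow_right₀ hq1.le
          have h3 : 2 * p * b ≤ N := by omega
          have h4 : ((p * M : ℕ) : ℤ) ≤ ((N - 2 * p * b : ℕ) : ℤ) := by exact_mod_cast hM1
          rw [Nat.cast_sub h3] at h4
          push_cast at h4 ⊢
          linarith) hmpos hpm hm0 hmax
      have hdeg : (D i j).natDegree ≤ n := by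
        have h1 := hDd i j
        have h2 := hGd i
        have h3 := hp.two_le
        have h4 : 2 * (D i j).natDegree ≤ p * (G i).natDegree := Nat.mul_le_mul h3 h1
        omega
      obtain ⟨k, R, β, hk, hR0, hRn, hRT, hRβ, hβ⟩ := hc (D i j) M hdeg hMc ⟨l', hl', hl'0, hle'⟩
      refine ⟨p * k, R, β, ?_, hR0, by omega, ?_, hRβ, ?_⟩
      · rw [pow_succ']
        exact Nat.mul_le_mul_left p hk
      · calc p * k * degT R = p * (k * degT R) := mul_assoc _ _ _
          _ ≤ p * degT (D i j) := Nat.mul_le_mul_left p hRT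
          _ ≤ degT (G i) := hDT i j
          _ ≤ degT P := hGT i
      · rw [mul_comm, pow_mul]
        refine (pow_le_pow_left' hβ p).trans ?_
        rw [← zpow_natCast, ← zpow_mul]
        apply zpow_le_zpow_right₀ hq1.le
        have h4 : (N : ℤ) < ((p * M + p + 2 * p * b : ℕ) : ℤ) := by
          exact_mod_cast (by omega : N < p * M + p + 2 * p * b)
        push_cast at h4 ⊢
        linarith
    · have hδv : absVal F (HahnSeries.single (N : ℤ) (1 : F)) = Δ := absVal_single _ one_ne_zero
      have hδ : (HahnSeries.single (N : ℤ) (1 : F) : Kinf F) ≠ 0 := by simp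
      obtain ⟨β, hR0, hRβ, hβ⟩ := exists_root_hasseDeriv (δ := HahnSeries.single (N : ℤ) (1 : F))
        hδ hmpos (by rwa [Ne, CharP.cast_eq_zero_iff F p]) hm0
        (by rw [hδv]; exact hmax) (by rw [hδv]; exact hlt)
      refine ⟨1, _, β, Nat.one_le_pow _ _ hp.pos, hR0, ?_, ?_, hRβ, ?_⟩
      · exact (natDegree_hasseDeriv_le P (m - 1)).trans (by omega)
      · rw [one_mul]
        exact degT_hasseDeriv_le _ _
      · rw [pow_one]
        refine hβ.trans ?_
        rw [hδv, hΔ]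
        exact zpow_le_zpow_right₀ hq1.le (by omega)

end RootNear

/-! ### Ultrametric bounds and invariance for resultants. -/

section Resultant

theorem valuation_natCast_le_one {K Γ : Type*} [Ring K] [LinearOrderedCommMonoidWithZero Γ]
    (v : Valuation K Γ) (k : ℕ) : v (k : K) ≤ 1 := by
  induction k with
  | zero => simp
  | succ k ih =>
    rw [Nat.cast_succ]
    exact (v.map_add _ _).trans (max_le ih v.map_one.le)

variable {K : Type*} [Field K] (v : Valuation K ℝ≥0)

theorem valuation_det_le {ι : Type*} [Fintype ι] [DecidableEq ι] (A : Matrix ι ι K) {b : ℝ≥0}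
    (h : ∀ σ : Equiv.Perm ι, ∏ i, v (A i (σ i)) ≤ b) : v A.det ≤ b := by
  rw [← Matrix.det_transpose, Matrix.det_apply']
  refine v.map_sum_le fun σ _ => ?_
  rw [v.map_mul, map_prod]
  have : v ((Equiv.Perm.sign σ : ℤ) : K) = 1 := by
    rcases Int.units_eq_one_or (Equiv.Perm.sign σ) with h | h <;> simp [h]
  rw [this, one_mul]
  exact h σ

/-- If `g` vanishes at `0`, the resultant of `f` and `g` is divisible by `f.coeff 0`. -/
theorem valuation_resultant_le {f g : K[X]} {m n : ℕ} {M L : ℝ≥0}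
    (hf : ∀ i, v (f.coeff i) ≤ M) (hg : ∀ i, v (g.coeff i) ≤ L) (hg0 : g.coeff 0 = 0)
    (hn : 0 < n) :
    v (resultant f g m n) ≤ v (f.coeff 0) * L ^ m * M ^ (n - 1) := by
  obtain ⟨r, rfl⟩ := Nat.exists_eq_add_of_le' hn
  set w : Fin (m + (r + 1)) → ℝ≥0 :=
    Fin.addCases (fun _ => L) (Fin.cons (v (f.coeff 0)) fun _ => M) with hw
  have hprod : ∏ j, w j = v (f.coeff 0) * L ^ m * M ^ r := by
    rw [Fin.prod_univ_add, Fin.prod_univ_succ]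
    simp only [hw, Fin.addCases_left, Fin.addCases_right, Fin.cons_zero, Fin.cons_succ,
      Finset.prod_const, Finset.card_univ, Fintype.card_fin]
    ring
  rw [Nat.add_sub_cancel, ← hprod, resultant]
  refine valuation_det_le v _ fun σ => ?_
  rw [← Equiv.prod_comp σ w]
  set i₀ : Fin (m + (r + 1)) := ⟨0, by omega⟩ with hi₀
  -- The only possibly nonzero entry of row 0 is `f.coeff 0`, in column `Fin.natAdd m 0`; a
  -- permutation that avoids it contributes 0.
  by_cases hσ : σ i₀ = Fin.natAdd m 0
  · refine Finset.prod_le_prod' fun i _ => ?_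
    obtain ⟨j, hj⟩ : ∃ j, j = σ i := ⟨_, rfl⟩
    rw [← hj]
    induction j using Fin.addCases with
    | left j =>
      simp only [sylvester, Matrix.of_apply, Fin.addCases_left, hw]
      split_ifs
      · exact hg _
      · simp
    | right j =>
      simp only [sylvester, Matrix.of_apply, Fin.addCases_right, hw]
      induction j using Fin.cases with
      | zero =>
        have : i = i₀ := σ.injective (by rw [hσ, hj])
        subst this
        simp [hi₀]
      | succ j =>
        rw [Fin.cons_succ]
        split_ifs
        · exact hf _
        · simp
  · refine (Finset.prod_eq_zero (Finset.mem_univ i₀) ?_).trans_le zero_le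
    obtain ⟨j, hj⟩ : ∃ j, j = σ i₀ := ⟨_, rfl⟩
    rw [← hj] at hσ ⊢
    induction j using Fin.addCases with
    | left j =>
      simp only [sylvester, Matrix.of_apply, Fin.addCases_left, hi₀, Nat.zero_sub, hg0]
      simp
    | right j =>
      simp only [sylvester, Matrix.of_apply, Fin.addCases_right, hi₀, Set.mem_Icc]
      rw [if_neg, map_zero]
      intro h
      apply hσ
      congr 1
      ext
      simpa using h.1

/-- A bound for the resultant of `f` and its derivative by the three lowest coefficients and the
leading one. -/
theorem valuation_resultant_derivative_le {f : K[X]} {d : ℕ} (hd : 2 ≤ d)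
    {M E Δ : ℝ≥0} (hΔ : Δ ≤ 1) (hM : ∀ i, v (f.coeff i) ≤ M) (h0 : v (f.coeff 0) ≤ E * Δ)
    (h1 : v (f.coeff 1) ≤ E) (h2 : v (f.coeff 2) * Δ ≤ E) :
    v (resultant f (derivative f) d (d - 1)) ≤ E ^ 2 * v (f.coeff d) * M ^ (2 * d - 4) := by
  have hder : ∀ i, v ((derivative f).coeff i) ≤ v (f.coeff (i + 1)) := by
    intro i
    rw [coeff_derivative, v.map_mul, ← Nat.cast_succ]
    exact mul_le_of_le_one_right' (valuation_natCast_le_one v _)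
  set A := sylvester f (derivative f) d (d - 1) with hA
  have hAM : ∀ i j, v (A i j) ≤ M := by
    intro i j
    induction j using Fin.addCases <;>
    · simp only [hA, sylvester, Matrix.of_apply, Fin.addCases_left, Fin.addCases_right]
      split_ifs
      · first | exact hM _ | exact (hder _).trans (hM _)
      · simp
  have hlast : ∀ j, v (A ⟨2 * d - 2, by omega⟩ j) ≤ v (f.coeff d) := by
    intro j
    induction j using Fin.addCases with
    | left j =>
      simp only [hA, sylvester, Matrix.of_apply, Fin.addCases_left, Set.mem_Icc]
      split_ifs with h
      · refine (hder _).trans_eq ?_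
        congr 2
        omega
      · simp
    | right j =>
      simp only [hA, sylvester, Matrix.of_apply, Fin.addCases_right, Set.mem_Icc]
      split_ifs with h
      · apply le_of_eq
        congr 2
        omega
      · simp
  have hE0 : E * Δ ≤ E := mul_le_of_le_one_right' hΔ
  have hrow0 : ∀ j : Fin (d + (d - 1)), v (A ⟨0, by omega⟩ j) ≤ E ∧
      ((j : ℕ) ≠ 0 → v (A ⟨0, by omega⟩ j) ≤ E * Δ) := by
    intro j
    induction j using Fin.addCases with
    | left j =>
      simp only [hA, sylvester, Matrix.of_apply, Fin.addCases_left, Set.mem_Icc, Fin.val_castAdd]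
      refine ⟨?_, fun hj => ?_⟩
      · split_ifs with h
        · rw [Nat.zero_sub]
          exact (hder 0).trans h1
        · simp
      · rw [if_neg (by omega)]
        simp
    | right j =>
      simp only [hA, sylvester, Matrix.of_apply, Fin.addCases_right, Set.mem_Icc, Nat.zero_sub]
      have : v (if (j : ℕ) ≤ 0 ∧ 0 ≤ (j : ℕ) + d then f.coeff 0 else 0) ≤ E * Δ := by
        split_ifs
        · exact h0
        · simp
      exact ⟨this.trans hE0, fun _ => this⟩
  have hrow1 : ∀ j : Fin (d + (d - 1)), v (A ⟨1, by omega⟩ j) * Δ ≤ E ∧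
      ((j : ℕ) ≠ 0 → v (A ⟨1, by omega⟩ j) ≤ E) := by
    intro j
    induction j using Fin.addCases with
    | left j =>
      simp only [hA, sylvester, Matrix.of_apply, Fin.addCases_left, Set.mem_Icc, Fin.val_castAdd]
      split_ifs with h
      · obtain hj | hj : (j : ℕ) = 0 ∨ (j : ℕ) = 1 := by omega
        · rw [hj]
          exact ⟨(mul_le_mul_left (hder 1) Δ).trans h2, fun h => absurd rfl h⟩
        · rw [hj]
          have := (hder 0).trans h1
          exact ⟨(mul_le_of_le_one_right' hΔ).trans this, fun _ => this⟩
      · simp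
    | right j =>
      simp only [hA, sylvester, Matrix.of_apply, Fin.addCases_right, Set.mem_Icc]
      have : v (if (j : ℕ) ≤ 1 ∧ 1 ≤ (j : ℕ) + d then f.coeff (1 - j) else 0) ≤ E := by
        split_ifs with h
        · obtain hj | hj : (j : ℕ) = 0 ∨ (j : ℕ) = 1 := by omega
          · rw [hj]
            exact h1
          · rw [hj]
            exact h0.trans hE0
        · simp
      exact ⟨(mul_le_of_le_one_right' hΔ).trans this, fun _ => this⟩
  rw [resultant]
  refine valuation_det_le v _ fun σ => ?_
  set i₀ : Fin (d + (d - 1)) := ⟨0, by omega⟩ with hi₀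
  set i₁ : Fin (d + (d - 1)) := ⟨1, by omega⟩ with hi₁
  set i₂ : Fin (d + (d - 1)) := ⟨2 * d - 2, by omega⟩ with hi₂
  -- The coefficient of index 2 can occur in row 1 only in column 0. If row 0 takes that column, row
  -- 1 is bounded by E; otherwise row 0 supplies a spare factor Δ that pays for it.
  have hpair : v (A i₀ (σ i₀)) * v (A i₁ (σ i₁)) ≤ E ^ 2 := by
    rw [sq]
    by_cases h : (σ i₀ : ℕ) = 0
    · refine mul_le_mul' (hrow0 _).1 ((hrow1 _).2 fun h' => ?_)
      have := σ.injective (Fin.ext (h.trans h'.symm))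
      simp [hi₀, hi₁] at this
    · calc v (A i₀ (σ i₀)) * v (A i₁ (σ i₁)) ≤ E * Δ * v (A i₁ (σ i₁)) :=
            mul_le_mul_left ((hrow0 _).2 h) _
        _ = E * (v (A i₁ (σ i₁)) * Δ) := by ring
        _ ≤ E * E := mul_le_mul_right (hrow1 _).1 _
  have h01 : i₁ ≠ i₀ := by simp [hi₀, hi₁]
  have h02 : i₂ ≠ i₀ := by simp [hi₀, hi₂]; omega
  have h12 : i₂ ≠ i₁ := by simp [hi₁, hi₂]; omega
  rw [← Finset.mul_prod_erase _ _ (Finset.mem_univ i₀),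
    ← Finset.mul_prod_erase _ _ (Finset.mem_erase.2 ⟨h01, Finset.mem_univ _⟩),
    ← Finset.mul_prod_erase _ _ (Finset.mem_erase.2 ⟨h12, Finset.mem_erase.2
      ⟨h02, Finset.mem_univ _⟩⟩), ← mul_assoc, ← mul_assoc]
  refine mul_le_mul' (mul_le_mul' hpair (hlast _)) ?_
  refine (Finset.prod_le_pow_card _ _ M fun i _ => hAM i _).trans_eq ?_
  congr 1
  rw [Finset.card_erase_of_mem (Finset.mem_erase.2 ⟨h12, Finset.mem_erase.2
      ⟨h02, Finset.mem_univ _⟩⟩), Finset.card_erase_of_mem (Finset.mem_erase.2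
      ⟨h01, Finset.mem_univ _⟩), Finset.card_erase_of_mem (Finset.mem_univ _), Finset.card_univ,
      Fintype.card_fin]
  omega

/-- The formal degree n is kept free because in characteristic p a derivative may have degree below
d - 1. Padding multiplies by a power of the leading coefficient of f, up to sign, and shifts
preserve it. -/
theorem resultant_taylor_of_natDegree_le {R : Type*} [CommRing R] (f g : R[X]) (r : R) {n : ℕ}
    (hg : g.natDegree ≤ n) :
    resultant (taylor r f) (taylor r g) f.natDegree n = resultant f g f.natDegree n := by
  obtain ⟨k, rfl⟩ := Nat.exists_eq_add_of_le hg
  rw [resultant_add_right_deg _ _ _ _ _ le_rfl,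
    resultant_add_right_deg _ _ _ _ _ (natDegree_taylor g r).le]
  have h1 := resultant_taylor f g r
  rw [natDegree_taylor, natDegree_taylor] at h1
  rw [h1, ← natDegree_taylor f r, coeff_natDegree, leadingCoeff_taylor, natDegree_taylor,
    coeff_natDegree]

theorem isCoprime_map_of_irreducible {A L : Type*} [CommRing A] [IsDomain A]
    [NormalizedGCDMonoid A] [Field L] [Algebra A L] [IsFractionRing A L] {P Q : A[X]}
    (hQ : Irreducible Q) (hd : Q.natDegree ≠ 0)
    (h : ¬ Q.map (algebraMap A L) ∣ P.map (algebraMap A L)) :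
    IsCoprime (P.map (algebraMap A L)) (Q.map (algebraMap A L)) := by
  have : Irreducible (Q.map (algebraMap A L)) :=
    ((hQ.isPrimitive hd).irreducible_iff_irreducible_map_fraction_map).1 hQ
  exact (this.coprime_iff_not_dvd.2 h).symm

theorem resultant_ne_zero_of_isCoprime_map {A L : Type*} [CommRing A] [IsDomain A]
    [Field L] [Algebra A L] [IsFractionRing A L] {P Q : A[X]} (hP : P ≠ 0) {n : ℕ}
    (hn : Q.natDegree ≤ n)
    (h : IsCoprime (P.map (algebraMap A L)) (Q.map (algebraMap A L))) :
    resultant P Q P.natDegree n ≠ 0 := by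
  have hinj := IsFractionRing.injective A L
  obtain ⟨k, rfl⟩ := Nat.exists_eq_add_of_le hn
  rw [resultant_add_right_deg _ _ _ _ _ le_rfl]
  refine mul_ne_zero (pow_ne_zero _ (by simpa using hP)) fun h0 => ?_
  have h1 := resultant_ne_zero _ _ h
  rw [natDegree_map_eq_of_injective hinj, natDegree_map_eq_of_injective hinj,
    resultant_map_map, h0, map_zero] at h1
  exact h1 rfl

theorem exists_fractionRing_hom {A K : Type*} [CommRing A] [IsDomain A] [Field K] {f : A →+* K}
    (hf : Function.Injective f) :
    ∃ φ : FractionRing A →+* K, φ.comp (algebraMap A (FractionRing A)) = f :=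
  ⟨IsFractionRing.lift hf, RingHom.ext fun x => IsFractionRing.lift_algebraMap hf x⟩

end Resultant

/-! ### Arithmetic lower bounds: discriminants and Liouville's inequality. -/

section LowerBounds

variable {F : Type*} [Field F]

theorem evalAt_eq_zero_of_map_dvd {P Q : F[X][X]} {ξ : Kinf F}
    (h : Q.map (algebraMap F[X] (FractionRing F[X])) ∣
      P.map (algebraMap F[X] (FractionRing F[X]))) (hQ : evalAt ξ Q = 0) : evalAt ξ P = 0 := by
  obtain ⟨φ, hφ⟩ := exists_fractionRing_hom (embed_injective (F := F))
  obtain ⟨S, hS⟩ := h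
  have h1 := congrArg (eval₂ φ ξ) hS
  rw [eval₂_mul, eval₂_map, eval₂_map, hφ] at h1
  change evalAt ξ P = evalAt ξ Q * _ at h1
  rw [h1, hQ, zero_mul]

variable [Finite F]

theorem natDegree_ne_zero_of_evalAt_eq_zero {P : F[X][X]} (hP : P ≠ 0) {ξ : Kinf F}
    (hξ : evalAt ξ P = 0) : P.natDegree ≠ 0 := by
  intro h
  have := absVal_evalAt_of_natDegree_eq_zero h hP ξ
  rw [hξ, map_zero] at this
  exact (pow_pos card_pos _).ne this

/-- Two polynomials with a common root, the first of which is irreducible: every root of the first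
is a root of the second. -/
theorem evalAt_eq_zero_of_irreducible {P Q : F[X][X]} (hP : Irreducible P) {ξ α : Kinf F}
    (hPξ : evalAt ξ P = 0) (hQξ : evalAt ξ Q = 0) (hPα : evalAt α P = 0) : evalAt α Q = 0 := by
  classical
  by_contra hQα
  obtain ⟨φ, hφ⟩ := exists_fractionRing_hom (embed_injective (F := F))
  obtain ⟨a, b, hab⟩ := isCoprime_map_of_irreducible (L := FractionRing F[X]) (P := Q) hP
    (natDegree_ne_zero_of_evalAt_eq_zero hP.ne_zero hPξ)
    fun h => hQα (evalAt_eq_zero_of_map_dvd h hPα)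
  have h1 := congrArg (eval₂ φ ξ) hab
  rw [eval₂_add, eval₂_mul, eval₂_mul, eval₂_map, eval₂_map, hφ, eval₂_one] at h1
  change _ * evalAt ξ Q + _ * evalAt ξ P = 1 at h1
  simp [hPξ, hQξ] at h1

/-- The discriminant of a separable irreducible polynomial has absolute value at least `1`; this
bounds from below its Taylor coefficients of low order at any point. -/
theorem one_le_mul_pow_of_separable {P : F[X][X]} (hP : Irreducible P) (hd : 2 ≤ P.natDegree)
    (hsep : derivative P ≠ 0) {ξ : Kinf F} {M E Δ : ℝ≥0} (hΔ : Δ ≤ 1)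
    (hM : ∀ i, absVal F (taylorCoeff ξ P i) ≤ M) (h0 : absVal F (taylorCoeff ξ P 0) ≤ E * Δ)
    (h1 : absVal F (taylorCoeff ξ P 1) ≤ E) (h2 : absVal F (taylorCoeff ξ P 2) * Δ ≤ E) :
    1 ≤ E * M ^ (P.natDegree - 2) := by
  classical
  set d := P.natDegree with hd'
  let L := FractionRing F[X]
  have hinj := IsFractionRing.injective F[X] L
  have hirr : Irreducible (P.map (algebraMap F[X] L)) :=
    ((hP.isPrimitive (by omega)).irreducible_iff_irreducible_map_fraction_map).1 hP
  have hcop : IsCoprime (P.map (algebraMap F[X] L)) ((derivative P).map (algebraMap F[X] L)) := by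
    rw [← derivative_map]
    apply (separable_iff_derivative_ne_zero hirr).2
    rw [derivative_map]
    rwa [Ne, Polynomial.map_eq_zero_iff hinj]
  have hdd : (derivative P).natDegree ≤ d - 1 := natDegree_derivative_le P
  have hres := resultant_ne_zero_of_isCoprime_map hP.ne_zero hdd hcop
  have hdisc := resultant_deriv (natDegree_pos_iff_degree_pos.1 (by omega : 0 < P.natDegree))
  have hD : P.discr ≠ 0 := by
    intro h
    rw [h, mul_zero] at hdisc
    exact hres hdisc
  have hmap : embed F (resultant P (derivative P) d (d - 1)) =
      resultant (taylor ξ (P.map (embed F))) (derivative (taylor ξ (P.map (embed F)))) d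
        (d - 1) := by
    have hd2 : (P.map (embed F)).natDegree = d := natDegree_map_eq_of_injective embed_injective _
    have hcomm : derivative (taylor ξ (P.map (embed F))) =
        taylor ξ (derivative (P.map (embed F))) := by
      rw [taylor_apply, taylor_apply, derivative_comp]
      simp
    have := resultant_taylor_of_natDegree_le (P.map (embed F)) (derivative (P.map (embed F))) ξ
      (n := d - 1) (by rw [← hd2]; exact natDegree_derivative_le _)
    rw [hd2] at this
    rw [hcomm, this, derivative_map, resultant_map_map]
  have hlc : (taylor ξ (P.map (embed F))).coeff d = embed F P.leadingCoeff := by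
    have hd2 : (taylor ξ (P.map (embed F))).natDegree = d := by
      rw [natDegree_taylor]
      exact natDegree_map_eq_of_injective embed_injective _
    rw [← hd2, coeff_natDegree, leadingCoeff_taylor, leadingCoeff_map_of_injective embed_injective]
  have hlc0 : 0 < absVal F (embed F P.leadingCoeff) :=
    zero_lt_iff.2 ((absVal F).ne_zero_iff.2 (embed_ne_zero (leadingCoeff_ne_zero.2 hP.ne_zero)))
  have hup := valuation_resultant_derivative_le (absVal F) (f := taylor ξ (P.map (embed F))) hd hΔ
    hM h0 h1 h2
  -- The resultant is, up to sign, the leading coefficient times the discriminant. The leading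
  -- coefficient cancels against the one in the upper bound, and what remains is a square.
  have hlow : absVal F (embed F P.leadingCoeff) ≤
      absVal F (embed F (resultant P (derivative P) d (d - 1))) := by
    rw [hdisc, (embed F).map_mul, (embed F).map_mul, (absVal F).map_mul, (absVal F).map_mul]
    have h3 : absVal F (embed F ((-1) ^ (P.natDegree * (P.natDegree - 1) / 2))) = 1 := by
      rw [map_pow, map_neg, map_one, Valuation.map_pow, Valuation.map_neg, Valuation.map_one,
        one_pow]
    rw [h3, one_mul]
    exact le_mul_of_one_le_right' (one_le_absVal_embed hD)
  rw [hlc, ← hmap] at hup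
  have h4 : 1 ≤ (E * M ^ (d - 2)) ^ 2 := by
    have h5 := hlow.trans hup
    have h6 : 2 * d - 4 = (d - 2) * 2 := by omega
    rw [mul_pow, ← pow_mul, ← h6]
    refine le_of_mul_le_mul_left ?_ hlc0
    rw [mul_one]
    refine h5.trans_eq ?_
    ring
  exact (one_le_sq_iff₀ zero_le).1 h4

/-- Liouville's inequality. -/
theorem exists_le_absVal_evalAt_of_algebraic {ξ : Kinf F} {Q : F[X][X]} (hQ : Irreducible Q)
    (hQξ : evalAt ξ Q = 0) {n : ℕ} (hQn : Q.natDegree ≤ n) :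
    ∃ c : ℝ≥0, 0 < c ∧ ∀ P : F[X][X], P.natDegree ≤ n → evalAt ξ P ≠ 0 →
      c ≤ absVal F (evalAt ξ P) * ((Nat.card F : ℝ≥0) ^ degT P) ^ (n - 1) := by
  classical
  let L := FractionRing F[X]
  have hd := natDegree_ne_zero_of_evalAt_eq_zero hQ.ne_zero hQξ
  set B : ℝ≥0 := max 1 (absVal F ξ) with hB
  have hB1 : 1 ≤ B := le_max_left _ _
  set q : ℝ≥0 := (Nat.card F : ℝ≥0) with hq
  have hq1 : 1 ≤ q := one_lt_card.le
  set D : ℝ≥0 := (B ^ n * q ^ degT Q) ^ n * (B ^ n) ^ (n - 1) with hD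
  have hB0 : 0 < B := zero_lt_one.trans_le hB1
  have hq0 : 0 < q := card_pos
  have hD0 : 0 < D := by positivity
  refine ⟨D⁻¹, inv_pos.2 hD0, fun P hPn hPξ => ?_⟩
  have hcop : IsCoprime (P.map (algebraMap F[X] L)) (Q.map (algebraMap F[X] L)) :=
    isCoprime_map_of_irreducible hQ hd fun h => hPξ (evalAt_eq_zero_of_map_dvd h hQξ)
  have hP0 : P ≠ 0 := by
    rintro rfl
    simp [evalAt] at hPξ
  have hres := resultant_ne_zero_of_isCoprime_map hP0 le_rfl hcop
  have hmap : embed F (resultant P Q P.natDegree Q.natDegree) =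
      resultant (taylor ξ (P.map (embed F))) (taylor ξ (Q.map (embed F))) P.natDegree
        Q.natDegree := by
    have := resultant_taylor_of_natDegree_le (P.map (embed F)) (Q.map (embed F)) ξ le_rfl
    rw [natDegree_map_eq_of_injective embed_injective,
      natDegree_map_eq_of_injective embed_injective] at this
    rw [this, resultant_map_map]
  -- After the shift by ξ, the constant coefficient of Q vanishes and that of P is P(ξ).
  have hup := valuation_resultant_le (absVal F) (f := taylor ξ (P.map (embed F)))
    (g := taylor ξ (Q.map (embed F))) (m := P.natDegree) (n := Q.natDegree)
    (fun i => absVal_taylorCoeff_le hB1 (le_max_right _ _) hPn i)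
    (fun i => absVal_taylorCoeff_le hB1 (le_max_right _ _) hQn i)
    ((taylorCoeff_zero ξ Q).trans hQξ) (Nat.pos_of_ne_zero hd)
  rw [← hmap] at hup
  have hlow := (one_le_absVal_embed hres).trans hup
  rw [show (taylor ξ (P.map (embed F))).coeff 0 = evalAt ξ P from taylorCoeff_zero ξ P] at hlow
  rw [inv_le_iff_one_le_mul₀ hD0]
  refine hlow.trans ?_
  calc absVal F (evalAt ξ P) * (B ^ n * q ^ degT Q) ^ P.natDegree *
        (B ^ n * q ^ degT P) ^ (Q.natDegree - 1)
      ≤ absVal F (evalAt ξ P) * (B ^ n * q ^ degT Q) ^ n * (B ^ n * q ^ degT P) ^ (n - 1) := by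
        gcongr
        · exact one_le_mul (one_le_pow₀ hB1) (one_le_pow₀ hq1)
        · exact one_le_mul (one_le_pow₀ hB1) (one_le_pow₀ hq1)
    _ = absVal F (evalAt ξ P) * (q ^ degT P) ^ (n - 1) * D := by
        rw [hD, mul_pow (B ^ n) (q ^ degT P)]
        ring

end LowerBounds

/-! ### Exponents as uniform lower bounds, and the inequality w* ≤ w. -/

section UniformBounds

theorem exists_pos_forall_le_of_finite {ι : Type*} {S : Set ι} (hS : S.Finite) (f : ι → ℝ≥0)
    (hf : ∀ i ∈ S, 0 < f i) : ∃ c, 0 < c ∧ ∀ i ∈ S, c ≤ f i := by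
  rcases S.eq_empty_or_nonempty with rfl | hne
  · exact ⟨1, one_pos, by simp⟩
  · obtain ⟨i, hi, hmin⟩ := Set.exists_min_image S f hS hne
    exact ⟨f i, hf i hi, hmin⟩

variable {F : Type*} [Field F]

/-- `|P(ξ)|` is at least a constant times `H(P) ^ (-ω)`, whenever it does not vanish and
`deg P ≤ n`. -/
def LowerBound (n : ℕ) (ξ : Kinf F) (ω : ℝ) : Prop :=
  ∃ c : ℝ≥0, 0 < c ∧ ∀ P : F[X][X], P.natDegree ≤ n → evalAt ξ P ≠ 0 →
    c * height P ^ (-ω) ≤ absv (evalAt ξ P)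

/-- `|ξ - α|` is at least a constant times `H(α) ^ (-s - 1)`, for `α ≠ ξ` algebraic of degree at
most `n`. -/
def StarLowerBound (n : ℕ) (ξ : Kinf F) (s : ℝ) : Prop :=
  ∃ c : ℝ≥0, 0 < c ∧ ∀ (α : Kinf F) (P : F[X][X]), IsMinDefPoly α P → P.natDegree ≤ n → α ≠ ξ →
    c * height P ^ (-s - 1) ≤ absv (ξ - α)

theorem finite_setOf_evalAt_eq_zero {P : F[X][X]} (hP : P ≠ 0) :
    {α : Kinf F | evalAt α P = 0}.Finite := by
  classical
  have h : P.map (embed F) ≠ 0 := by rwa [Ne, Polynomial.map_eq_zero_iff embed_injective]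
  refine (P.map (embed F)).roots.toFinset.finite_toSet.subset fun α hα => ?_
  simp only [Finset.mem_coe, Multiset.mem_toFinset]
  rw [mem_roots h, IsRoot, ← evalAt_eq_eval_map]
  exact hα

variable [Finite F]

theorem absv_pos_iff {x : Kinf F} : 0 < absv x ↔ x ≠ 0 := by
  rw [← absVal_apply, zero_lt_iff, (absVal F).ne_zero_iff]

theorem height_rpow_le {P : F[X][X]} (hP : P ≠ 0) {s t : ℝ} (h : s ≤ t) :
    height P ^ s ≤ height P ^ t :=
  NNReal.rpow_le_rpow_of_exponent_le (one_le_height hP) h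

theorem LowerBound.mono {n : ℕ} {ξ : Kinf F} {ω ω' : ℝ} (h : LowerBound n ξ ω) (hω : ω ≤ ω') :
    LowerBound n ξ ω' := by
  obtain ⟨c, hc, H⟩ := h
  refine ⟨c, hc, fun P hP hξ => (mul_le_mul_right ?_ c).trans (H P hP hξ)⟩
  have hP0 : P ≠ 0 := by
    rintro rfl
    simp [evalAt] at hξ
  exact height_rpow_le hP0 (neg_le_neg hω)

theorem StarLowerBound.mono {n : ℕ} {ξ : Kinf F} {s s' : ℝ} (h : StarLowerBound n ξ s)
    (hs : s ≤ s') : StarLowerBound n ξ s' := by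
  obtain ⟨c, hc, H⟩ := h
  exact ⟨c, hc, fun α P hP hn hα => (mul_le_mul_right
    (height_rpow_le hP.1.ne_zero (by linarith)) c).trans (H α P hP hn hα)⟩

theorem finite_setOf_height_le (n : ℕ) (b : ℝ≥0) :
    {P : F[X][X] | P.natDegree ≤ n ∧ height P ≤ b}.Finite := by
  obtain ⟨k, hk⟩ := pow_unbounded_of_one_lt b (one_lt_card (F := F))
  refine (finite_setOf_degT_le n k).subset fun P hP => ⟨hP.1, ?_⟩
  by_cases h0 : P = 0
  · simp [h0, degT]
  · have := hP.2.trans_lt hk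
    rw [height_eq h0] at this
    exact ((pow_lt_pow_iff_right₀ one_lt_card).1 this).le

theorem finite_setOf_height_rpow_lt (n : ℕ) {c : ℝ≥0} (hc : 0 < c) {s t : ℝ} (h : t < s) :
    {P : F[X][X] | P.natDegree ≤ n ∧ P ≠ 0 ∧ c * height P ^ s < height P ^ t}.Finite := by
  refine (finite_setOf_height_le n ((c⁻¹) ^ (s - t)⁻¹)).subset ?_
  rintro P ⟨hP, hP0, hlt⟩
  refine ⟨hP, ?_⟩
  have hH : 0 < height P := zero_lt_one.trans_le (one_le_height hP0)
  rw [NNReal.le_rpow_inv_iff (sub_pos.2 h), NNReal.rpow_sub hH.ne',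
    div_le_iff₀ (NNReal.rpow_pos hH), ← div_eq_inv_mul, le_div_iff₀ hc, mul_comm]
  exact hlt.le

theorem LowerBound.wExp_le {n : ℕ} {ξ : Kinf F} {ω : ℝ} (h : LowerBound n ξ ω) :
    wExp n ξ ≤ ω := by
  obtain ⟨c, hc, H⟩ := h
  refine sSup_le ?_
  rintro _ ⟨w, hw, rfl⟩
  rw [EReal.coe_le_coe_iff]
  by_contra! hlt
  refine hw ((finite_setOf_height_rpow_lt n hc (neg_lt_neg hlt)).subset ?_)
  rintro P ⟨hP, h0, h1⟩
  have hξ := absv_pos_iff.1 h0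
  refine ⟨hP, ?_, (H P hP hξ).trans_lt h1⟩
  rintro rfl
  simp [evalAt] at hξ

/-- The finitely many exceptions to the bound with constant 1 are absorbed into the constant. -/
theorem lowerBound_of_wExp_lt {n : ℕ} {ξ : Kinf F} {ω : ℝ} (h : wExp n ξ < ω) :
    LowerBound n ξ ω := by
  have hfin : {P : F[X][X] | P.natDegree ≤ n ∧ 0 < absv (evalAt ξ P) ∧
      absv (evalAt ξ P) < height P ^ (-ω)}.Finite := by
    by_contra hinf
    have : (ω : EReal) ≤ wExp n ξ := le_sSup ⟨ω, hinf, rfl⟩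
    exact absurd this (not_le.2 h)
  obtain ⟨c, hc, hcle⟩ := exists_pos_forall_le_of_finite hfin
    (fun P => absv (evalAt ξ P) / height P ^ (-ω)) fun P ⟨_, h0, h1⟩ =>
      div_pos h0 (zero_le.trans_lt h1)
  refine ⟨min c 1, lt_min hc one_pos, fun P hP hξ => ?_⟩
  have hP0 : P ≠ 0 := by
    rintro rfl
    simp [evalAt] at hξ
  have hH : 0 < height P ^ (-ω) := NNReal.rpow_pos (zero_lt_one.trans_le (one_le_height hP0))
  rcases lt_or_ge (absv (evalAt ξ P)) (height P ^ (-ω)) with hlt | hge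
  · have := hcle P ⟨hP, absv_pos_iff.2 hξ, hlt⟩
    rw [le_div_iff₀ hH] at this
    exact (mul_le_mul_left (min_le_left _ _) _).trans this
  · exact (mul_le_of_le_one_left' (min_le_right _ _)).trans hge

theorem StarLowerBound.wStarExp_le {n : ℕ} {ξ : Kinf F} {s : ℝ} (h : StarLowerBound n ξ s) :
    wStarExp n ξ ≤ s := by
  obtain ⟨c, hc, H⟩ := h
  refine sSup_le ?_
  rintro _ ⟨w, hw, rfl⟩
  rw [EReal.coe_le_coe_iff]
  by_contra! hlt
  refine hw (((finite_setOf_height_rpow_lt n hc (by linarith : -w - 1 < -s - 1)).biUnion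
    (t := fun P => {α : Kinf F | evalAt α P = 0}) fun P hP =>
      finite_setOf_evalAt_eq_zero hP.2.1).subset ?_)
  rintro α ⟨P, hP, hn, h0, h1⟩
  have hne : α ≠ ξ := by
    rintro rfl
    simp [absv] at h0
  exact Set.mem_biUnion ⟨hn, hP.1.ne_zero, (H α P hP hn hne).trans_lt h1⟩ hP.2

/-- For -1 ≤ s the power of the height is at most 1, so the least distance among the finitely many
exceptions serves as a constant. -/
theorem starLowerBound_of_wStarExp_lt {n : ℕ} {ξ : Kinf F} {s : ℝ} (hs : -1 ≤ s)
    (h : wStarExp n ξ < s) : StarLowerBound n ξ s := by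
  have hfin : {α : Kinf F | ∃ P : F[X][X], IsMinDefPoly α P ∧ P.natDegree ≤ n ∧
      0 < absv (ξ - α) ∧ absv (ξ - α) < height P ^ (-s - 1)}.Finite := by
    by_contra hinf
    have : (s : EReal) ≤ wStarExp n ξ := le_sSup ⟨s, hinf, rfl⟩
    exact absurd this (not_le.2 h)
  obtain ⟨c, hc, hcle⟩ := exists_pos_forall_le_of_finite hfin (fun α => absv (ξ - α))
    fun α ⟨_, _, _, h0, _⟩ => h0
  refine ⟨min c 1, lt_min hc one_pos, fun α P hP hn hα => ?_⟩
  rcases lt_or_ge (absv (ξ - α)) (height P ^ (-s - 1)) with hlt | hge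
  · have h1 := hcle α ⟨P, hP, hn, absv_pos_iff.2 (sub_ne_zero.2 hα.symm), hlt⟩
    have h2 : height P ^ (-s - 1) ≤ 1 :=
      NNReal.rpow_le_one_of_one_le_of_nonpos (one_le_height hP.1.ne_zero) (by linarith)
    exact (mul_le_of_le_one_right' h2).trans ((min_le_left _ _).trans h1)
  · exact (mul_le_of_le_one_left' (min_le_right _ _)).trans hge

theorem exists_isMinDefPoly_dvd {R : F[X][X]} (hR : R ≠ 0) {β : Kinf F} (hβ : evalAt β R = 0) :
    ∃ P, IsMinDefPoly β P ∧ P ∣ R := by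
  induction R using WfDvdMonoid.induction_on_irreducible with
  | zero => exact absurd rfl hR
  | unit u hu =>
    exact absurd (natDegree_eq_zero_of_isUnit hu) (natDegree_ne_zero_of_evalAt_eq_zero hR hβ)
  | mul a i ha hi ih =>
    rw [evalAt_mul, mul_eq_zero] at hβ
    rcases hβ with h | h
    · exact ⟨i, ⟨hi, h⟩, dvd_mul_right _ _⟩
    · obtain ⟨P, hP, hdvd⟩ := ih ha h
      exact ⟨P, hP, hdvd.mul_left _⟩

/-- The lower bound for the distance to algebraic elements, in terms of any polynomial vanishing
there. -/
theorem StarLowerBound.exists_le {n : ℕ} {ξ : Kinf F} {s : ℝ} (h : StarLowerBound n ξ s)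
    (hs : -1 ≤ s) : ∃ c : ℝ≥0, 0 < c ∧ ∀ (β : Kinf F) (R : F[X][X]), R ≠ 0 → R.natDegree ≤ n →
      evalAt β R = 0 → β ≠ ξ → c * height R ^ (-s - 1) ≤ absVal F (ξ - β) := by
  obtain ⟨c, hc, H⟩ := h
  refine ⟨c, hc, fun β R hR hn hβ hne => ?_⟩
  obtain ⟨P, hP, hdvd⟩ := exists_isMinDefPoly_dvd hR hβ
  refine le_trans (mul_le_mul_right ?_ c) (H β P hP ((natDegree_le_of_dvd hdvd hR).trans hn) hne)
  refine NNReal.rpow_le_rpow_of_nonpos (zero_lt_one.trans_le (one_le_height hP.1.ne_zero)) ?_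
    (by linarith)
  rw [height_eq hR, height_eq hP.1.ne_zero]
  exact pow_le_pow_right₀ one_lt_card.le (degT_le_of_dvd hdvd hR)

theorem exists_absVal_sub_embed_le (x : Kinf F) : ∃ c : F[X], absVal F (x - embed F c) ≤ 1 := by
  set N := x.order.natAbs + 1 with hN
  set c : F[X] := ∑ i ∈ Finset.range N, monomial i (x.coeff (-(i : ℤ))) with hc
  refine ⟨c, ?_⟩
  by_cases h0 : x - embed F c = 0
  · simp [h0]
  rw [absVal_apply, absv_of_ne_zero h0]
  apply zpow_le_one_of_nonpos₀ one_lt_card.le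
  by_contra! hlt
  have h1 := HahnSeries.coeff_order_eq_zero.not.2 h0
  apply h1
  set k := (x - embed F c).order with hk
  obtain ⟨i, hi⟩ : ∃ i : ℕ, k = -(i : ℤ) := ⟨k.natAbs, by omega⟩
  rw [hi, HahnSeries.coeff_sub, coeff_embed, if_pos (by omega), hc, finsetSum_coeff]
  simp only [coeff_monomial, Int.natAbs_neg, Int.natAbs_natCast, Finset.sum_ite_eq',
    Finset.mem_range]
  split_ifs with hiN
  · exact sub_self _
  · rw [sub_zero]
    exact HahnSeries.coeff_eq_zero_of_lt_order (by omega)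

/-- The fractions a / T^k, with a close to T^k ξ, have height at most q^(k+b) and lie within q^(-k)
of ξ; letting k grow forces s ≥ 0. -/
theorem StarLowerBound.nonneg {n : ℕ} (hn : 1 ≤ n) {ξ : Kinf F} {s : ℝ}
    (h : StarLowerBound n ξ s) (hs : -1 ≤ s) : 0 ≤ s := by
  obtain ⟨c, hc, H⟩ := h.exists_le hs
  by_contra! hneg
  set q : ℝ≥0 := (Nat.card F : ℝ≥0) with hq
  have hq1 : 1 < q := one_lt_card
  have hq0 : 0 < q := card_pos
  obtain ⟨b, hb⟩ : ∃ b : ℕ, absVal F ξ ≤ q ^ b := by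
    obtain ⟨b, hb⟩ := pow_unbounded_of_one_lt (absVal F ξ) hq1
    exact ⟨b, hb.le⟩
  have key : ∀ k : ℕ, c * (q ^ (k + b)) ^ (-s - 1) ≤ (q ^ k)⁻¹ := by
    intro k
    have hT : embed F (X ^ k) ≠ 0 := embed_ne_zero (pow_ne_zero _ X_ne_zero)
    obtain ⟨a, ha, hne⟩ : ∃ a : F[X], absVal F (embed F (X ^ k) * ξ - embed F a) ≤ 1 ∧
        embed F (X ^ k) * ξ ≠ embed F a := by
      obtain ⟨a, ha⟩ := exists_absVal_sub_embed_le (embed F (X ^ k) * ξ)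
      by_cases hne : embed F (X ^ k) * ξ = embed F a
      -- The fraction must differ from ξ, so a is moved by 1 when T^k ξ is itself a polynomial.
      · refine ⟨a + 1, ?_, ?_⟩
        · rw [map_add, map_one, hne, sub_add_cancel_left, Valuation.map_neg, Valuation.map_one]
        · rw [hne, map_add, map_one]
          simp
      · exact ⟨a, ha, hne⟩
    set R : F[X][X] := C (X ^ k) * X - C a with hR
    have hR1 : R.coeff 1 = X ^ k := by
      rw [hR, coeff_sub, coeff_C_mul, coeff_X_one, coeff_C_succ, mul_one, sub_zero]
    have hR0 : R ≠ 0 := by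
      intro h0
      rw [h0, coeff_zero] at hR1
      exact pow_ne_zero k X_ne_zero hR1.symm
    have hRT : degT R ≤ k + b := by
      have hab : a.natDegree ≤ k + b := by
        by_cases ha0 : a = 0
        · simp [ha0]
        have h1 : absVal F (embed F a) ≤ q ^ (k + b) := by
          have h2 := (absVal F).map_sub (embed F (X ^ k) * ξ) (embed F (X ^ k) * ξ - embed F a)
          rw [sub_sub_cancel] at h2
          refine h2.trans (max_le ?_ (ha.trans (one_le_pow₀ hq1.le)))
          rw [(absVal F).map_mul, absVal_embed_X_pow, pow_add]
          exact mul_le_mul_right hb _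
        rw [absVal_embed ha0] at h1
        exact (pow_le_pow_iff_right₀ hq1).1 h1
      rw [degT_le_iff]
      intro i
      rw [hR, coeff_sub, coeff_C_mul, coeff_X, coeff_C]
      refine (natDegree_sub_le _ _).trans (max_le ?_ ?_)
      · split_ifs <;> simp
      · split_ifs
        · exact hab
        · simp
    have hβ : evalAt (embed F a / embed F (X ^ k)) R = 0 := by
      rw [evalAt, hR, eval₂_sub, eval₂_mul, eval₂_C, eval₂_C, eval₂_X, mul_div_cancel₀ _ hT,
        sub_self]
    have hβne : embed F a / embed F (X ^ k) ≠ ξ := by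
      rw [Ne, div_eq_iff hT, mul_comm]
      exact fun h => hne h.symm
    have hdeg : R.natDegree ≤ n := by
      refine (natDegree_sub_le _ _).trans (max_le ?_ ?_)
      · exact (natDegree_C_mul_le _ _).trans (natDegree_X_le.trans hn)
      · simp
    have h1 := H _ R hR0 hdeg hβ hβne
    have h2 : absVal F (ξ - embed F a / embed F (X ^ k)) ≤ (q ^ k)⁻¹ := by
      have h3 : ξ - embed F a / embed F (X ^ k) =
          (embed F (X ^ k) * ξ - embed F a) / embed F (X ^ k) := by
        field_simp
      rw [h3, map_div₀, absVal_embed_X_pow, ← one_div]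
      gcongr
    refine le_trans (mul_le_mul_right ?_ c) (h1.trans h2)
    refine NNReal.rpow_le_rpow_of_nonpos (zero_lt_one.trans_le (one_le_height hR0)) ?_
      (by linarith)
    rw [height_eq hR0]
    exact pow_le_pow_right₀ hq1.le hRT
  have hlt : q ^ s < 1 := NNReal.rpow_lt_one_of_one_lt_of_neg hq1 hneg
  obtain ⟨k, hk⟩ := exists_pow_lt_of_lt_one
    (mul_pos hc (NNReal.rpow_pos (p := -s - 1) (pow_pos hq0 b))) hlt
  have h1 := key k
  rw [pow_add, NNReal.mul_rpow, ← one_div, le_div_iff₀ (pow_pos hq0 k)] at h1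
  have h2 : (q ^ k) ^ (-s - 1) = ((q ^ k) * (q ^ s) ^ k)⁻¹ := by
    rw [← NNReal.rpow_natCast (q ^ s) k, ← NNReal.rpow_natCast q k, ← NNReal.rpow_mul,
      ← NNReal.rpow_mul, ← NNReal.rpow_add hq0.ne', ← NNReal.rpow_neg]
    congr 1
    ring
  rw [h2] at h1
  have h3 : 0 < (q ^ s) ^ k := pow_pos (NNReal.rpow_pos hq0) k
  have h4 : c * (((q ^ k) * (q ^ s) ^ k)⁻¹ * (q ^ b) ^ (-s - 1)) * q ^ k =
      c * (q ^ b) ^ (-s - 1) / (q ^ s) ^ k := by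
    have : q ^ k ≠ 0 := (pow_pos hq0 k).ne'
    field_simp
  rw [h4, div_le_one h3] at h1
  exact absurd hk (not_lt.2 h1)

/-- The constant polynomials T^k have value and height of the same size q^k. -/
theorem LowerBound.neg_one_le {n : ℕ} {ξ : Kinf F} {ω : ℝ} (h : LowerBound n ξ ω) :
    -1 ≤ ω := by
  obtain ⟨c, hc, H⟩ := h
  by_contra! hlt
  set q : ℝ≥0 := (Nat.card F : ℝ≥0) with hq
  have hq1 : 1 < q := one_lt_card
  have hq0 : 0 < q := card_pos
  obtain ⟨k, hk⟩ := exists_pow_lt_of_lt_one hc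
    (NNReal.rpow_lt_one_of_one_lt_of_neg hq1 (by linarith : ω + 1 < 0))
  have hP0 : (C (X ^ k) : F[X][X]) ≠ 0 := C_ne_zero.2 (pow_ne_zero _ X_ne_zero)
  have hv : evalAt ξ (C (X ^ k)) = embed F (X ^ k) := eval₂_C _ _
  have h1 := H (C (X ^ k)) (by simp) (by rw [hv]; exact embed_ne_zero (pow_ne_zero _ X_ne_zero))
  have h2 := absVal_evalAt_of_natDegree_eq_zero (natDegree_C _) hP0 ξ
  rw [hv, ← height_eq hP0, absVal_embed_X_pow] at h2
  rw [hv, ← h2, ← absVal_apply, absVal_embed_X_pow, NNReal.rpow_neg, ← div_eq_mul_inv,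
    div_le_iff₀ (NNReal.rpow_pos (pow_pos card_pos k))] at h1
  refine absurd hk (not_lt.2 (h1.trans_eq ?_))
  rw [← NNReal.rpow_natCast (q ^ (ω + 1)), ← NNReal.rpow_natCast, ← NNReal.rpow_mul,
      ← NNReal.rpow_mul, ← NNReal.rpow_add hq0.ne']
  congr 1
  ring

theorem LowerBound.starLowerBound {n : ℕ} {ξ : Kinf F} {ω : ℝ} (h : LowerBound n ξ ω) :
    StarLowerBound n ξ ω := by
  have hω := h.neg_one_le
  obtain ⟨c, hc, H⟩ := h
  -- When P(ξ) = 0 the hypothesis says nothing; but then α is one of the finitely many conjugates of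
  -- ξ.
  obtain ⟨c', hc', H'⟩ : ∃ c' : ℝ≥0, 0 < c' ∧ ∀ (α : Kinf F) (P : F[X][X]), IsMinDefPoly α P →
      evalAt ξ P = 0 → α ≠ ξ → c' ≤ absv (ξ - α) := by
    by_cases hex : ∃ Q, IsMinDefPoly ξ Q
    · obtain ⟨Q, hQ⟩ := hex
      obtain ⟨c', hc', H'⟩ := exists_pos_forall_le_of_finite
        ((finite_setOf_evalAt_eq_zero hQ.1.ne_zero).sdiff (t := {ξ})) (fun α => absv (ξ - α))
        fun α hα => absv_pos_iff.2 (sub_ne_zero.2 fun h => hα.2 h.symm)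
      exact ⟨c', hc', fun α P hP hPξ hα =>
        H' α ⟨evalAt_eq_zero_of_irreducible hP.1 hPξ hQ.2 hP.2, hα⟩⟩
    · exact ⟨1, one_pos, fun α P hP hPξ _ => absurd ⟨P, hP.1, hPξ⟩ hex⟩
  set B : ℝ≥0 := max 1 (absVal F ξ) with hB
  have hB1 : 1 ≤ B := le_max_left _ _
  have hB0 : 0 < B := zero_lt_one.trans_le hB1
  refine ⟨min (min c' 1) (c / B ^ n), lt_min (lt_min hc' one_pos) (by positivity),
    fun α P hP hn hα => ?_⟩
  have hH1 := one_le_height hP.1.ne_zero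
  have hH0 : 0 < height P := zero_lt_one.trans_le hH1
  have hle1 : height P ^ (-ω - 1) ≤ 1 :=
    NNReal.rpow_le_one_of_one_le_of_nonpos hH1 (by linarith)
  rcases le_or_gt 1 (absv (ξ - α)) with hd | hd
  · exact (mul_le_one' ((min_le_left _ _).trans (min_le_right _ _)) hle1).trans hd
  by_cases hξ : evalAt ξ P = 0
  · exact (mul_le_of_le_one_right' hle1).trans
      (((min_le_left _ _).trans (min_le_left _ _)).trans (H' α P hP hξ hα))
  have h1 := H P hn hξ
  have h2 : absv (evalAt ξ P) ≤ absv (ξ - α) * (B ^ n * height P) := by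
    have h3 : (taylor ξ (P.map (embed F))).eval (α - ξ) = 0 := by
      rw [taylor_eval, sub_add_cancel, ← evalAt_eq_eval_map, hP.2]
    rw [eval_eq_sum_range, Finset.sum_range_succ', pow_zero, mul_one] at h3
    change _ + taylorCoeff ξ P 0 = 0 at h3
    rw [taylorCoeff_zero] at h3
    rw [← absVal_apply, eq_neg_of_add_eq_zero_right h3, Valuation.map_neg]
    refine (absVal F).map_sum_le fun i _ => ?_
    rw [(absVal F).map_mul, (absVal F).map_pow, pow_succ, mul_comm, (absVal F).map_sub_swap,
      height_eq hP.1.ne_zero]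
    refine mul_le_mul' (mul_le_of_le_one_left' (pow_le_one' hd.le i)) ?_
    exact absVal_taylorCoeff_le hB1 (le_max_right _ _) hn _
  calc min (min c' 1) (c / B ^ n) * height P ^ (-ω - 1)
      ≤ c / B ^ n * height P ^ (-ω - 1) := mul_le_mul_left (min_le_right _ _) _
    _ = c * height P ^ (-ω) / (B ^ n * height P) := by
        rw [NNReal.rpow_sub_one hH0.ne', div_mul_div_comm]
    _ ≤ absv (ξ - α) := by
        rw [div_le_iff₀ (by positivity)]
        exact h1.trans h2

end UniformBounds

/-! ### From distances to values of polynomials. -/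

section Transfer

variable {F : Type*} [Field F] [Finite F]

/-- For P = aX + b with root β, |P(ξ)| = |a| |ξ - β|, and H(P) ≪ |a| unless |P(ξ)| ≥ 1. The
discriminant argument needs degree at least 2. -/
theorem StarLowerBound.exists_le_of_natDegree_eq_one {n : ℕ} {ξ : Kinf F} {s : ℝ} (hn : 1 ≤ n)
    (hs : 0 ≤ s) (h : StarLowerBound n ξ s)
    (hT : ∀ R : F[X][X], R ≠ 0 → R.natDegree ≤ n → evalAt ξ R ≠ 0) :
    ∃ c : ℝ≥0, 0 < c ∧ ∀ P : F[X][X], P.natDegree = 1 →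
      c * height P ^ (-s) ≤ absVal F (evalAt ξ P) := by
  obtain ⟨c, hc, H⟩ := h.exists_le (by linarith)
  set B : ℝ≥0 := max 1 (absVal F ξ) with hB
  have hB1 : 1 ≤ B := le_max_left _ _
  have hB0 : 0 < B := zero_lt_one.trans_le hB1
  refine ⟨min 1 (c / B), lt_min one_pos (by positivity), fun P hP => ?_⟩
  have hP0 : P ≠ 0 := by
    rintro rfl
    simp at hP
  have hH1 := one_le_height hP0
  have hH0 : 0 < height P := zero_lt_one.trans_le hH1
  rcases le_or_gt 1 (absVal F (evalAt ξ P)) with h1 | h1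
  · refine le_trans (mul_le_one' (min_le_left _ _) ?_) h1
    exact NNReal.rpow_le_one_of_one_le_of_nonpos hH1 (by linarith)
  set a := P.coeff 1 with ha
  set b := P.coeff 0 with hb
  have hPab : P = C a * X + C b := P.eq_X_add_C_of_natDegree_le_one hP.le
  have ha0 : a ≠ 0 := by
    rw [ha, ← hP, coeff_natDegree]
    exact leadingCoeff_ne_zero.2 hP0
  have hae := embed_ne_zero ha0
  have hav := one_le_absVal_embed ha0
  have heval : ∀ x : Kinf F, evalAt x P = embed F a * x + embed F b := by
    intro x
    rw [evalAt, hPab, eval₂_add, eval₂_mul, eval₂_C, eval₂_C, eval₂_X]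
  have hβ : evalAt (-embed F b / embed F a) P = 0 := by
    rw [heval, mul_div_cancel₀ _ hae, neg_add_cancel]
  have hne : -embed F b / embed F a ≠ ξ := fun h => hT P hP0 (by omega) (h ▸ hβ)
  have h2 := H _ P hP0 (by omega) hβ hne
  have h3 : absVal F (ξ - -embed F b / embed F a) * absVal F (embed F a) =
      absVal F (evalAt ξ P) := by
    rw [← (absVal F).map_mul, heval]
    congr 1
    field_simp
    ring
  have h4 : height P ≤ B * absVal F (embed F a) := by
    refine Finset.sup_le fun i _ => ?_
    rcases Nat.lt_or_ge 1 i with hi | hi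
    · rw [coeff_eq_zero_of_natDegree_lt (by omega)]
      simp [absv]
    · interval_cases i
      · have : embed F (P.coeff 0) = evalAt ξ P - embed F a * ξ := by
          rw [heval]
          ring
        rw [← absVal_apply, this]
        refine ((absVal F).map_sub _ _).trans (max_le ?_ ?_)
        · exact h1.le.trans (one_le_mul hB1 hav)
        · rw [(absVal F).map_mul, mul_comm]
          exact mul_le_mul_left (le_max_right _ _) _
      · exact le_mul_of_one_le_left' hB1
  calc min 1 (c / B) * height P ^ (-s) ≤ c / B * height P ^ (-s) :=
        mul_le_mul_left (min_le_right _ _) _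
    _ = c * height P ^ (-s - 1) * (height P / B) := by
        rw [NNReal.rpow_sub_one hH0.ne']
        field_simp
    _ ≤ absVal F (ξ - -embed F b / embed F a) * absVal F (embed F a) := by
        refine mul_le_mul' h2 ?_
        rw [div_le_iff₀ hB0, mul_comm]
        exact h4
    _ = absVal F (evalAt ξ P) := h3

theorem StarLowerBound.exists_le_of_separable {n : ℕ} {ξ : Kinf F} {s : ℝ}
    (hs : 0 ≤ s) (h : StarLowerBound n ξ s)
    (hT : ∀ R : F[X][X], R ≠ 0 → R.natDegree ≤ n → evalAt ξ R ≠ 0) :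
    ∃ c : ℝ≥0, 0 < c ∧ ∀ P : F[X][X], Irreducible P → 2 ≤ P.natDegree → P.natDegree ≤ n →
      derivative P ≠ 0 → c * height P ^ (-(s + n - 1)) ≤ absVal F (evalAt ξ P) := by
  obtain ⟨p, hpF⟩ := CharP.exists F
  have hp : p.Prime := (CharP.char_is_prime_or_zero F p).resolve_right
    (CharP.char_ne_zero_of_finite F p)
  have : Fact p.Prime := ⟨hp⟩
  obtain ⟨c₀, hc₀, H⟩ := h.exists_le (by linarith)
  obtain ⟨k₀, hk₀⟩ := exists_root_near p ξ n
  set q : ℝ≥0 := (Nat.card F : ℝ≥0) with hq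
  have hq1 : 1 < q := one_lt_card
  have hq0 : 0 < q := card_pos
  obtain ⟨b, hb⟩ : ∃ b : ℕ, absVal F ξ ≤ q ^ b := by
    obtain ⟨b, hb⟩ := pow_unbounded_of_one_lt (absVal F ξ) hq1
    exact ⟨b, hb.le⟩
  set c₁ : ℝ≥0 := min 1 c₀ with hc₁
  have hc₁0 : 0 < c₁ := lt_min one_pos hc₀
  have hc₁1 : c₁ ≤ 1 := min_le_left _ _
  refine ⟨c₁ ^ p ^ n / (q ^ (k₀ + 1) * q ^ (b * n * n)), by positivity,
    fun P hP hd2 hdn hsep => ?_⟩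
  set d := P.natDegree with hd
  have hP0 := hP.ne_zero
  have hH1 := one_le_height hP0
  have hH0 : 0 < height P := zero_lt_one.trans_le hH1
  have hξ := hT P hP0 hdn
  obtain ⟨a, ha⟩ := exists_absVal_eq hξ
  set M : ℝ≥0 := q ^ (b * n + degT P) with hM
  -- The radius is q^e = q |P(ξ)| M^(d-2); the extra factor q makes the discriminant inequality fail
  -- strictly.
  set e : ℤ := a + ((b * n + degT P) * (d - 2) : ℕ) + 1 with he
  have heq : q ^ e = q * (absVal F (evalAt ξ P) * M ^ (d - 2)) := by
    rw [he, ha, hM, ← pow_mul, zpow_add₀ hq0.ne', zpow_add₀ hq0.ne', zpow_natCast, zpow_one,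
      mul_comm]
  have key : c₁ ^ p ^ n * height P ^ (-s - 1) ≤ q ^ k₀ * q ^ e := by
    have hle1 : height P ^ (-s - 1) ≤ 1 :=
      NNReal.rpow_le_one_of_one_le_of_nonpos hH1 (by linarith)
    rcases lt_or_ge (-e) k₀ with hlt | hge
    · refine (mul_le_one' (pow_le_one' hc₁1 _) hle1).trans ?_
      rw [← zpow_natCast, ← zpow_add₀ hq0.ne']
      exact one_le_zpow₀ hq1.le (by omega)
    obtain ⟨N, hN⟩ : ∃ N : ℕ, e = -(N : ℤ) := ⟨(-e).toNat, by omega⟩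
    have hnewton : ∃ l, 0 < l ∧ taylorCoeff ξ P l ≠ 0 ∧ absVal F (taylorCoeff ξ P 0) ≤
        absVal F (taylorCoeff ξ P l) * (q ^ (-N : ℤ)) ^ l := by
      -- Otherwise |P(ξ)| would dominate all terms, and the discriminant bound with E = |P(ξ)| / Δ
      -- would give 1 ≤ 1 / q.
      by_contra! hcon
      rw [← hN] at hcon
      set Δ : ℝ≥0 := q ^ e with hΔ
      have hΔ0 : 0 < Δ := zpow_pos hq0 _
      set p₀ := absVal F (taylorCoeff ξ P 0) with hp₀
      have hp₀' : p₀ = absVal F (evalAt ξ P) := by rw [hp₀, taylorCoeff_zero]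
      have hle : ∀ l, 0 < l → absVal F (taylorCoeff ξ P l) * Δ ^ l ≤ p₀ := by
        intro l hl
        by_cases h0 : taylorCoeff ξ P l = 0
        · rw [h0, map_zero, zero_mul]
          exact zero_le
        · exact (hcon l hl h0).le
      have h1 := one_le_mul_pow_of_separable hP hd2 hsep (ξ := ξ) (M := M) (E := p₀ / Δ) (Δ := Δ)
        (zpow_le_one_of_nonpos₀ hq1.le (by omega))
        (fun i => by
          rw [hM, pow_add, pow_mul]
          exact absVal_taylorCoeff_le (one_le_pow₀ hq1.le) hb hdn i)
        (by rw [div_mul_cancel₀ _ hΔ0.ne'])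
        (by
          rw [le_div_iff₀ hΔ0]
          simpa using hle 1 one_pos)
        (by
          rw [le_div_iff₀ hΔ0, mul_assoc, ← sq]
          exact hle 2 two_pos)
      rw [div_mul_eq_mul_div, one_le_div hΔ0, heq, hp₀'] at h1
      have h2 : 0 < absVal F (evalAt ξ P) * M ^ (d - 2) :=
        mul_pos (zero_lt_iff.2 ((absVal F).ne_zero_iff.2 hξ)) (pow_pos (pow_pos hq0 _) _)
      exact absurd h1 (not_le.2 (lt_mul_of_one_lt_left h2 hq1))
    obtain ⟨k, R, β, hk, hR0, hRn, hRT, hRβ, hβ⟩ := hk₀ P N hdn (by omega) hnewton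
    have hne : β ≠ ξ := fun h => hT R hR0 hRn (h ▸ hRβ)
    have h1 := (pow_le_pow_left' (H β R hR0 hRn hRβ hne) k).trans hβ
    rw [← zpow_natCast q k₀, ← zpow_add₀ hq0.ne', hN, ← sub_eq_add_neg]
    refine le_trans ?_ h1
    rw [mul_pow]
    refine mul_le_mul' ?_ ?_
    · exact (pow_le_pow_of_le_one zero_le hc₁1 hk).trans (pow_le_pow_left' (min_le_right _ _) k)
    · rw [← NNReal.rpow_natCast, ← NNReal.rpow_mul, mul_comm, NNReal.rpow_mul,
        NNReal.rpow_natCast]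
      refine NNReal.rpow_le_rpow_of_nonpos (pow_pos (zero_lt_one.trans_le (one_le_height hR0)) _)
        ?_ (by linarith)
      rw [height_eq hR0, height_eq hP0, ← pow_mul, mul_comm]
      exact pow_le_pow_right₀ hq1.le hRT
  -- This factor contributes n - 2 to the exponent s + 1 coming from the distance, hence s + n - 1
  -- in total.
  have hMle : M ^ (d - 2) ≤ q ^ (b * n * n) * height P ^ ((n : ℝ) - 2) := by
    rw [hM, pow_add, mul_pow, ← height_eq hP0, ← pow_mul]
    refine mul_le_mul' (pow_le_pow_right₀ hq1.le (Nat.mul_le_mul_left _ (by omega))) ?_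
    rw [← NNReal.rpow_natCast]
    apply NNReal.rpow_le_rpow_of_exponent_le hH1
    rw [Nat.cast_sub hd2]
    have : (d : ℝ) ≤ n := by exact_mod_cast hdn
    push_cast
    linarith
  rw [div_mul_eq_mul_div, div_le_iff₀ (by positivity)]
  have hexp : height P ^ (-(s + n - 1)) = height P ^ (-s - 1) / height P ^ ((n : ℝ) - 2) := by
    rw [← NNReal.rpow_sub hH0.ne']
    congr 1
    ring
  rw [hexp, ← mul_div_assoc, div_le_iff₀ (NNReal.rpow_pos hH0)]
  calc c₁ ^ p ^ n * height P ^ (-s - 1)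
      ≤ q ^ k₀ * (q * (absVal F (evalAt ξ P) * M ^ (d - 2))) := by rw [← heq]; exact key
    _ ≤ q ^ k₀ * (q * (absVal F (evalAt ξ P) *
          (q ^ (b * n * n) * height P ^ ((n : ℝ) - 2)))) := by gcongr
    _ = _ := by ring

/-- The constant has the form c^deg so that both sides are multiplicative in P. -/
theorem le_absVal_evalAt_of_irreducible {ξ : Kinf F} {c : ℝ≥0} {ω : ℝ} (hω : 0 ≤ ω) {m : ℕ}
    (h : ∀ P : F[X][X], Irreducible P → P.natDegree ≤ m → P.natDegree ≠ 0 →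
      c ^ P.natDegree * height P ^ (-ω) ≤ absVal F (evalAt ξ P))
    {P : F[X][X]} (hP0 : P ≠ 0) (hP : P.natDegree ≤ m) :
    c ^ P.natDegree * height P ^ (-ω) ≤ absVal F (evalAt ξ P) := by
  have hconst : ∀ P : F[X][X], P ≠ 0 → P.natDegree = 0 →
      c ^ P.natDegree * height P ^ (-ω) ≤ absVal F (evalAt ξ P) := by
    intro P hP0 hd
    rw [absVal_evalAt_of_natDegree_eq_zero hd hP0 ξ, ← height_eq hP0, hd, pow_zero, one_mul]
    exact (NNReal.rpow_le_one_of_one_le_of_nonpos (one_le_height hP0) (by linarith)).trans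
      (one_le_height hP0)
  induction P using WfDvdMonoid.induction_on_irreducible with
  | zero => exact absurd rfl hP0
  | unit u hu => exact hconst u hP0 (natDegree_eq_zero_of_isUnit hu)
  | mul a i ha hi ih =>
    have hdeg := natDegree_mul hi.ne_zero ha
    rw [hdeg] at hP ⊢
    have h1 := ih ha (by omega)
    have h2 : c ^ i.natDegree * height i ^ (-ω) ≤ absVal F (evalAt ξ i) := by
      by_cases h0 : i.natDegree = 0
      · exact hconst i hi.ne_zero h0
      · exact h i hi (by omega) h0
    have h3 : height (i * a) = height i * height a := by
      rw [height_eq hP0, height_eq ha, height_eq hi.ne_zero, degT_mul hi.ne_zero ha, pow_add]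
    rw [evalAt_mul, (absVal F).map_mul, h3, NNReal.mul_rpow, pow_add, mul_mul_mul_comm]
    exact mul_le_mul' h2 h1

/-- Lower bounds pass from the polynomials `D_j` to `P = ∑ T ^ j * D_j ^ p`. -/
theorem le_absVal_evalAt_of_derivative_eq_zero (p : ℕ) [Fact p.Prime] [CharP F p] {ξ : Kinf F}
    {c : ℝ≥0} (hc1 : c ≤ 1) {ω : ℝ} (hω : 0 ≤ ω) {P : F[X][X]} (hP0 : P ≠ 0)
    (hd : P.natDegree ≠ 0) (hder : derivative P = 0)
    (h : ∀ D : F[X][X], D ≠ 0 → D.natDegree < P.natDegree →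
      c ^ D.natDegree * height D ^ (-ω) ≤ absVal F (evalAt ξ D)) :
    c ^ P.natDegree * height P ^ (-ω) ≤ absVal F (evalAt ξ P) := by
  have hp := (Fact.out : p.Prime)
  have hPe : expand F[X] p (contract p P) = P := expand_contract p hder hp.ne_zero
  have hdeg : (contract p P).natDegree * p = P.natDegree := by
    rw [← natDegree_expand, hPe]
  have hdegT : degT (contract p P) ≤ degT P := by
    rw [degT_le_iff]
    intro i
    rw [coeff_contract hp.ne_zero]
    exact natDegree_coeff_le_degT P _
  obtain ⟨D, hD, hDd, hDT⟩ := exists_expand_eq_sum_pow p (contract p P) le_rfl le_rfl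
  rw [hPe] at hD
  -- Any nonzero D_j will do, since no cancellation occurs in ∑ T^j D_j(ξ)^p.
  obtain ⟨j, hj, hDj⟩ : ∃ j ∈ Finset.range p, D j ≠ 0 := by
    by_contra! hcon
    apply hP0
    rw [hD]
    refine Finset.sum_eq_zero fun j hj => ?_
    rw [hcon j hj, zero_pow hp.ne_zero, mul_zero]
  have hDlt : (D j).natDegree < P.natDegree := by
    have h1 := hDd j
    have h2 := hp.two_le
    have h3 : (contract p P).natDegree * 2 ≤ (contract p P).natDegree * p :=
      Nat.mul_le_mul_left _ h2
    omega
  have heval : evalAt ξ P = ∑ j ∈ Finset.range p, embed F (X ^ j) * evalAt ξ (D j) ^ p := by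
    conv_lhs => rw [hD]
    rw [evalAt, eval₂_finsetSum]
    refine Finset.sum_congr rfl fun j _ => ?_
    rw [eval₂_mul, eval₂_C, eval₂_pow, evalAt]
  have h1 : absVal F (evalAt ξ (D j)) ^ p ≤ absVal F (evalAt ξ P) := by
    rw [heval]
    refine le_trans ?_ (absVal_le_absVal_sum (fun j => evalAt ξ (D j)) (Finset.mem_range.1 hj))
    rw [(absVal F).map_mul, (absVal F).map_pow, absVal_embed_X_pow]
    exact le_mul_of_one_le_left' (one_le_pow₀ one_lt_card.le)
  refine le_trans ?_ ((pow_le_pow_left' (h (D j) hDj hDlt) p).trans h1)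
  rw [mul_pow, ← pow_mul, ← NNReal.rpow_natCast (height (D j) ^ (-ω)), ← NNReal.rpow_mul,
    mul_comm (-ω), NNReal.rpow_mul, NNReal.rpow_natCast]
  refine mul_le_mul' (pow_le_pow_of_le_one zero_le hc1 ?_) ?_
  · rw [← hdeg]
    exact Nat.mul_le_mul_right p (hDd j)
  · refine NNReal.rpow_le_rpow_of_nonpos
      (pow_pos (zero_lt_one.trans_le (one_le_height hDj)) _) ?_ (by linarith)
    rw [height_eq hDj, height_eq hP0, ← pow_mul, mul_comm]
    exact pow_le_pow_right₀ one_lt_card.le ((hDT j).trans hdegT)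

theorem StarLowerBound.lowerBound {n : ℕ} (hn : 1 ≤ n) {ξ : Kinf F} {s : ℝ} (hs : 0 ≤ s)
    (h : StarLowerBound n ξ s) : LowerBound n ξ (s + n - 1) := by
  have hn' : (1 : ℝ) ≤ n := by exact_mod_cast hn
  by_cases hT : ∀ R : F[X][X], R ≠ 0 → R.natDegree ≤ n → evalAt ξ R ≠ 0
  · obtain ⟨c₁, hc₁, H₁⟩ := h.exists_le_of_natDegree_eq_one hn hs hT
    obtain ⟨c₂, hc₂, H₂⟩ := h.exists_le_of_separable hs hT
    obtain ⟨p, hpF⟩ := CharP.exists F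
    have : Fact p.Prime := ⟨(CharP.char_is_prime_or_zero F p).resolve_right
      (CharP.char_ne_zero_of_finite F p)⟩
    set c : ℝ≥0 := min 1 (min c₁ c₂) with hc
    have hc0 : 0 < c := lt_min one_pos (lt_min hc₁ hc₂)
    have hc1 : c ≤ 1 := min_le_left _ _
    have hω : 0 ≤ s + n - 1 := by linarith
    have key : ∀ m ≤ n, ∀ P : F[X][X], P ≠ 0 → P.natDegree ≤ m →
        c ^ P.natDegree * height P ^ (-(s + n - 1)) ≤ absVal F (evalAt ξ P) := by
      intro m
      induction m with
      | zero =>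
        intro _ P hP0 hPm
        exact le_absVal_evalAt_of_irreducible hω (m := 0)
          (fun Q _ hQ hQ0 => absurd (Nat.le_zero.1 hQ) hQ0) hP0 hPm
      | succ m ih =>
        intro hm P hP0 hPm
        refine le_absVal_evalAt_of_irreducible hω (m := m + 1) (fun Q hQ hQm hQ0 => ?_) hP0 hPm
        by_cases hder : derivative Q = 0
        · exact le_absVal_evalAt_of_derivative_eq_zero p hc1 hω hQ.ne_zero hQ0 hder
            fun D hD0 hDQ => ih (by omega) D hD0 (by omega)
        have hcpow : c ^ Q.natDegree ≤ c := pow_le_of_le_one zero_le hc1 hQ0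
        by_cases hQ1 : Q.natDegree = 1
        · refine le_trans (mul_le_mul' (hcpow.trans ((min_le_right _ _).trans (min_le_left _ _)))
            (height_rpow_le hQ.ne_zero ?_)) (H₁ Q hQ1)
          linarith
        · exact (mul_le_mul_left (hcpow.trans ((min_le_right _ _).trans (min_le_right _ _)))
            _).trans (H₂ Q hQ (by omega) (by omega) hder)
    refine ⟨c ^ n, pow_pos hc0 n, fun P hP hξ => ?_⟩
    have hP0 : P ≠ 0 := by
      rintro rfl
      simp [evalAt] at hξ
    exact (mul_le_mul_left (pow_le_pow_of_le_one zero_le hc1 hP) _).trans (key n le_rfl P hP0 hP)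
  · push Not at hT
    obtain ⟨R, hR0, hRn, hRξ⟩ := hT
    obtain ⟨Q, hQ, hQR⟩ := exists_isMinDefPoly_dvd hR0 hRξ
    obtain ⟨c, hc, H⟩ := exists_le_absVal_evalAt_of_algebraic hQ.1 hQ.2
      ((natDegree_le_of_dvd hQR hR0).trans hRn)
    -- Liouville's inequality gives the exponent n - 1, which is at most s + n - 1 because s ≥ 0.
    refine LowerBound.mono (ω := (n - 1 : ℕ)) ⟨c, hc, fun P hP hξ => ?_⟩ ?_
    · have hP0 : P ≠ 0 := by
        rintro rfl
        simp [evalAt] at hξ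
      have h1 := H P hP hξ
      rw [← height_eq hP0] at h1
      rw [NNReal.rpow_neg, NNReal.rpow_natCast, ← div_eq_mul_inv,
        div_le_iff₀ (pow_pos (zero_lt_one.trans_le (one_le_height hP0)) _)]
      exact h1
    · rw [Nat.cast_sub hn]
      push_cast
      linarith

end Transfer

end PowerSeriesApprox

theorem theorem1p4 {F : Type*} [Field F] [Finite F] (ξ : PowerSeriesApprox.Kinf F)
    (n : ℕ) (hn : 1 ≤ n) :
    PowerSeriesApprox.wExp n ξ - (n : EReal) + 1 ≤ PowerSeriesApprox.wStarExp n ξ ∧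
      PowerSeriesApprox.wStarExp n ξ ≤ PowerSeriesApprox.wExp n ξ := by
  constructor
  · rw [← EReal.le_of_forall_lt_iff_le]
    intro s hs
    -- Truncation at -1 makes the uniform bound available; nonnegativity of the truncated value then
    -- shows that it equals s.
    have hs' : PowerSeriesApprox.wStarExp n ξ < (max s (-1) : ℝ) :=
      hs.trans_le (EReal.coe_le_coe_iff.2 (le_max_left _ _))
    have h1 := PowerSeriesApprox.starLowerBound_of_wStarExp_lt (le_max_right _ _) hs'
    have h2 := h1.nonneg hn (le_max_right _ _)
    have h3 : max s (-1) = s := by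
      rcases le_max_iff.1 h2 with h | h
      · exact max_eq_left (by linarith)
      · linarith
    rw [h3] at h1 h2
    have h4 := (h1.lowerBound hn h2).wExp_le
    calc PowerSeriesApprox.wExp n ξ - (n : EReal) + 1
        ≤ ((s + n - 1 : ℝ) : EReal) - (n : EReal) + 1 :=
          add_le_add_left (EReal.sub_le_sub h4 le_rfl) _
      _ = ((s + n - 1 - n + 1 : ℝ) : EReal) := by push_cast; rfl
      _ = s := by congr 1; ring
  · rw [← EReal.le_of_forall_lt_iff_le]
    intro ω hω
    exact (PowerSeriesApprox.lowerBound_of_wExp_lt hω).starLowerBound.wStarExp_le
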